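/- \textbf{Setting.} Let $\Theta,\mathcal A,\mathcal Y,\mathcal X$ be compact metrizable spaces with their Borel $\sigma$-algebras, $\mathcal A,\mathcal X\neq\emptyset$, and let $\mathcal H_t=(\mathcal Y\times\mathcal A)^{t-1}\times\mathcal Y$ for $t\ge 1$. Let $\nu$ be a prior on $\Theta$, $\rho_\theta$ the law of the first observation and $P_{\theta,t}(\cdot\mid h,a)$ the law of $Y_{t+1}$ given parameter $\theta$, history $h\in\mathcal H_t$ and query $a$; these are probability kernels, jointly measurable in all arguments, with jointly measurable densities $p_{\theta,0}$, $p_{\theta,t}(\cdot\mid h,a)$ with respect to fixed probability measures $\lambda_0$ and $\bar\lambda$ on $\mathcal Y$. Let $L_\theta:\mathcal X\to[0,\infty)$ be continuous with $\inf_x L_\theta(x)=0$, and measurable in $\theta$. Fix $\epsilon>0$ and $\lambda\ge 0$. For $h=(y_1,a_1,\dots,a_{t-1},y_t)$ let $\ell_t(\theta,h)=p_{\theta,0}(y_1)\prod_{s<t}p_{\theta,s}(y_{s+1}\mid h_s,a_s)$ be the likelihood, where $h_s=(y_1,a_1,\dots,a_{s-1},y_s)$. Call $h$ \emph{regular} if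 $0<\int\ell_t(\theta,h)\,\nu(d\theta)<\infty$; let $R_t(d\theta\mid h)=\ell_t(\theta,h)\,\nu(d\theta)/\int\ell_t(\theta',h)\,\nu(d\theta')$ for regular $h$ and $R_t(\cdot\mid h)=\nu$ otherwise. Let $\bar P_t(\cdot\mid h,a)=\int P_{\theta,t}(\cdot\mid h,a)\,R_t(d\theta\mid h)$ and $r_t(h)=\sup_{x\in\mathcal X}R_t(\{\theta:L_\theta(x)\le\epsilon\}\mid h)$. A policy is a sequence of probability kernels from $\mathcal H_t$ to $\mathcal A\cup\{a_{\rm stop}\}$, and $\tau$ is the first time at which it chooses $a_{\rm stop}$. It is admissible from an initial law if $\tau<\infty$ almost surely and $\mathbb E[\tau]<\infty$. The optimal cost-to-go is \[V_t^\star(h)=\inf\ \mathbb E\big[(\tau-t)-\lambda r_\tau(H_\tau)\,\big|\,H_t=h\big],\] the infimum being over the policies admissible from $h$, where $\theta\sim R_t(\cdot\mid h)$ and the later observations follow $P_{\theta,s}$. Put \[Q^\star_{t,\rm stop}(h)=-\lambda r_t(h),\qquad Q^\star_{t,\rm cont}(h,a)=1+\int V^\star_{t+1}(h,a,y)\,\bar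 P_t(dy\mid h,a),\] where, as long as measurability of $V^\star_{t+1}$ is not known, the integral is the lower integral (the supremum of the integrals of the integrable functions below the integrand). \textbf{Proposition.} Assume that for all $\theta$, $t$, $h$ the map $a\mapsto P_{\theta,t}(\cdot\mid h,a)$ is weakly continuous. (1) Let $a^\star_t:\mathcal H_t\to\mathcal A$, $t\ge1$, be measurable with $a^\star_t(h)\in\arg\min_{a\in\mathcal A}Q^\star_{t,\rm cont}(h,a)$ for every $t$ and every regular $h\in\mathcal H_t$. Then, for every regular $h\in\mathcal H_t$, the function $y\mapsto V^\star_{t+1}(h,a,y)$ is $\bar P_t(\cdot\mid h,a)$-integrable for every $a$ (so that the lower integral is the integral), and the Bellman equation \[V_t^\star(h)=\min\Big\{Q^\star_{t,\rm stop}(h),\ \inf_{a\in\mathcal A}Q^\star_{t,\rm cont}(h,a)\Big\}\] holds. There is a policy which, at every regular history $h$, stops if $Q^\star_{t,\rm stop}(h)\le Q^\star_{t,\rm cont}(h,a^\star_t(h))$ and otherwise queries $a^\star_t(h)$. Every such policy is optimal: from every regular $h\in\mathcal H_t$ it is admissible and its expected cost equals $V_t^\star(h)$; and from the start ($\theta\sim\nu$,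 $Y_1\sim\rho_\theta$) it is admissible and minimizes $\mathbb E[\tau-\lambda r_\tau(H_\tau)]$ among all admissible policies. (2) Under every policy, at every time up to and including the stopping time, the history is almost surely regular. (3) If, for some $t$ and $h\in\mathcal H_t$, the function $(a,y)\mapsto V^\star_{t+1}(h,a,y)$ is lower semicontinuous on $\mathcal A\times\mathcal Y$, then $a\mapsto Q^\star_{t,\rm cont}(h,a)$ is lower semicontinuous and attains its infimum over $\mathcal A$. -/

import Mathlib

open MeasureTheory ProbabilityTheory Set
open scoped ENNReal BoundedContinuousFunction

namespace SeqTest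

universe u₁ u₂ u₃ u₄

/-- Histories after `n` queries, `h = (y₁, (a₁, y₂), …, (aₙ, yₙ₊₁))`.  With the usual time index
`t = n + 1` (there is no query before the first observation), this is the space `𝓗_t`. -/
abbrev Hist (A : Type u₁) (Y : Type u₂) (n : ℕ) : Type (max u₁ u₂) := Y × (Fin n → A × Y)

/-- The history `(h, a, y)`. -/
def Hist.append {A : Type u₁} {Y : Type u₂} {n : ℕ} (h : Hist A Y n) (a : A) (y : Y) :
    Hist A Y (n + 1) :=
  (h.1, Fin.snoc (α := fun _ => A × Y) h.2 (a, y))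

/-- The part of the history that is available before the `(i+1)`-st query. -/
def Hist.before {A : Type u₁} {Y : Type u₂} {n : ℕ} (h : Hist A Y n) (i : Fin n) :
    Hist A Y i :=
  (h.1, fun j => h.2 (Fin.castLE i.isLt.le j))

/-- The Bayesian sequential testing model: a prior on the parameter `θ`, the law `init θ` of the
first observation, the (history-dependent) observation kernels `obs`, all of them dominated by
reference probability measures with jointly measurable densities, and a loss whose sublevel sets
are the sets of `ε`-optimal decisions. -/
structure Model (Θ : Type u₁) (A : Type u₂) (Y : Type u₃) (X : Type u₄)
    [MeasurableSpace Θ] [MeasurableSpace A] [MeasurableSpace Y] where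
  prior : Measure Θ
  prior_prob : IsProbabilityMeasure prior
  init : Kernel Θ Y
  init_markov : IsMarkovKernel init
  obs : ∀ n, Kernel (Θ × Hist A Y n × A) Y
  obs_markov : ∀ n, IsMarkovKernel (obs n)
  refInit : Measure Y
  refInit_prob : IsProbabilityMeasure refInit
  refObs : Measure Y
  refObs_prob : IsProbabilityMeasure refObs
  initDensity : Θ × Y → ℝ≥0∞
  measurable_initDensity : Measurable initDensity
  obsDensity : ∀ n, Θ × Hist A Y n × A × Y → ℝ≥0∞
  measurable_obsDensity : ∀ n, Measurable (obsDensity n)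
  init_eq : ∀ θ, init θ = refInit.withDensity (fun y => initDensity (θ, y))
  obs_eq : ∀ n θ h a,
    obs n (θ, h, a) = refObs.withDensity (fun y => obsDensity n (θ, h, a, y))
  loss : Θ → X → ℝ
  loss_nonneg : ∀ θ x, 0 ≤ loss θ x
  loss_inf : ∀ θ, ⨅ x, loss θ x = 0
  measurable_loss : ∀ x, Measurable (fun θ => loss θ x)

/-- A randomized policy on the augmented action space `A ∪ {a_stop}`, where `Sum.inl a` is the
query `a` and `Sum.inr ()` is the stop action. -/
structure Policy (A : Type u₁) (Y : Type u₂) [MeasurableSpace A] [MeasurableSpace Y] where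
  kern : ∀ n, Kernel (Hist A Y n) (A ⊕ Unit)
  markov : ∀ n, IsMarkovKernel (kern n)

/-- The lower integral of a real function: the supremum of the integrals of the integrable
functions below it.  It equals the integral whenever `f` is integrable, see
`lowerIntegral_eq_integral`; it serves to speak of the expectation of an optimal value before
that value is known to be measurable. -/
noncomputable def lowerIntegral {Y : Type u₁} [MeasurableSpace Y] (μ : Measure Y) (f : Y → ℝ) :
    ℝ :=
  ⨆ g : {g : Y → ℝ // Integrable g μ ∧ g ≤ᵐ[μ] f}, ∫ y, g.1 y ∂μ

theorem lowerIntegral_eq_integral {Y : Type u₁} [MeasurableSpace Y] (μ : Measure Y) (f : Y → ℝ)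
    (hf : Integrable f μ) : lowerIntegral μ f = ∫ y, f y ∂μ := by
  have : Nonempty {g : Y → ℝ // Integrable g μ ∧ g ≤ᵐ[μ] f} :=
    ⟨⟨f, hf, Filter.EventuallyLE.refl _ _⟩⟩
  have hb : ∀ g : {g : Y → ℝ // Integrable g μ ∧ g ≤ᵐ[μ] f},
      ∫ y, g.1 y ∂μ ≤ ∫ y, f y ∂μ := fun g => integral_mono_ae g.2.1 hf g.2.2
  refine le_antisymm (ciSup_le hb) ?_
  exact le_ciSup (f := fun g : {g : Y → ℝ // Integrable g μ ∧ g ≤ᵐ[μ] f} => ∫ y, g.1 y ∂μ)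
    ⟨_, by rintro _ ⟨g, rfl⟩; exact hb g⟩ ⟨f, hf, Filter.EventuallyLE.refl _ _⟩

section

variable {Θ : Type u₁} {A : Type u₂} {Y : Type u₃} {X : Type u₄}
  [MeasurableSpace Θ] [MeasurableSpace A] [MeasurableSpace Y]

theorem measurable_append_aux (n : ℕ) :
    Measurable (fun z : (Θ × Hist A Y n) × (A × Y) =>
      (z.1.1, Hist.append z.1.2 z.2.1 z.2.2)) := by
  unfold Hist.append
  refine Measurable.prodMk (by fun_prop) (Measurable.prodMk (by fun_prop) ?_)
  refine measurable_pi_lambda _ fun i => ?_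
  induction i using Fin.lastCases with
  | last => simpa using measurable_snd
  | cast i => simp only [Fin.snoc_castSucc]; fun_prop

theorem measurableEmbedding_query : MeasurableEmbedding (Sum.inl : A → A ⊕ Unit) :=
  ⟨Sum.inl_injective, measurable_inl, fun _ hs => hs.inl_image⟩

/-- The sub-Markov kernel of continuing: the law of the query on the event that the policy does
not stop. -/
noncomputable def Policy.cont (π : Policy A Y) (n : ℕ) : Kernel (Hist A Y n) A :=
  (π.kern n).comapRight measurableEmbedding_query

namespace Model

/-- One more query under `π`: from `(θ, h)` to `(θ, (h, a, y))`, on the event that `π` does not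
stop at `h`. -/
noncomputable def step (M : Model Θ A Y X) (π : Policy A Y) (n : ℕ) :
    Kernel (Θ × Hist A Y n) (Θ × Hist A Y (n + 1)) :=
  (Kernel.id ×ₖ
    ((π.cont n).comap Prod.snd measurable_snd ⊗ₖ
      (M.obs n).comap (fun z : (Θ × Hist A Y n) × A => (z.1.1, z.1.2, z.2)) (by fun_prop))).map
    (fun z => (z.1.1, Hist.append z.1.2 z.2.1 z.2.2))

/-- The law, started from `(θ, h)` after `n` queries, of the pair `(θ, history after n + k
queries)` on the event that `π` has chosen `k` further queries without stopping. -/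
noncomputable def run (M : Model Θ A Y X) (π : Policy A Y) (n : ℕ) :
    ∀ k, Kernel (Θ × Hist A Y n) (Θ × Hist A Y (n + k))
  | 0 => Kernel.id
  | k + 1 => M.step π (n + k) ∘ₖ M.run π n k

/-- The law of the stopped history `H_τ` on the event `τ < ∞`, where `τ` is the first time at
which `π` stops and `μ` is the joint law of the parameter and the history after `n` queries.  A
point `⟨m, h⟩` stands for stopping at the history `h` after `m` queries. -/
noncomputable def stoppedLaw (M : Model Θ A Y X) (π : Policy A Y) (n : ℕ)
    (μ : Measure (Θ × Hist A Y n)) : Measure (Σ m, Hist A Y m) :=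
  Measure.sum fun k =>
    (((μ.bind (M.run π n k)).map Prod.snd).withDensity
      (fun h => π.kern (n + k) h {Sum.inr ()})).map (Sigma.mk (n + k))

/-- `τ < ∞` almost surely and `𝔼[τ] < ∞`. -/
def Admissible (M : Model Θ A Y X) (π : Policy A Y) (n : ℕ) (μ : Measure (Θ × Hist A Y n)) :
    Prop :=
  M.stoppedLaw π n μ univ = 1 ∧
    Integrable (fun s : Σ m, Hist A Y m => (s.1 : ℝ)) (M.stoppedLaw π n μ)

/-- The likelihood of the history `h` under the parameter `θ`. -/
noncomputable def likelihood (M : Model Θ A Y X) (n : ℕ) (θ : Θ) (h : Hist A Y n) : ℝ≥0∞ :=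
  M.initDensity (θ, h.1) *
    ∏ i : Fin n, M.obsDensity i (θ, h.before i, (h.2 i).1, (h.2 i).2)

noncomputable def evidence (M : Model Θ A Y X) (n : ℕ) (h : Hist A Y n) : ℝ≥0∞ :=
  ∫⁻ θ, M.likelihood n θ h ∂M.prior

/-- The histories at which Bayes' formula makes sense. -/
def Regular (M : Model Θ A Y X) (n : ℕ) (h : Hist A Y n) : Prop :=
  M.evidence n h ≠ 0 ∧ M.evidence n h ≠ ∞

open Classical in
/-- The posterior on the parameter given the history, by Bayes' formula (and the prior at the
histories where the formula makes no sense, which have probability zero under every policy). -/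
noncomputable def posterior (M : Model Θ A Y X) (n : ℕ) (h : Hist A Y n) : Measure Θ :=
  if M.Regular n h then
    (M.evidence n h)⁻¹ • M.prior.withDensity (fun θ => M.likelihood n θ h)
  else M.prior

/-- Posterior probability that the decision `x` is `ε`-optimal. -/
noncomputable def successProb (M : Model Θ A Y X) (ε : ℝ) (n : ℕ) (h : Hist A Y n) (x : X) : ℝ :=
  (M.posterior n h).real {θ | M.loss θ x ≤ ε}

/-- The best posterior success probability `r(h)`. -/
noncomputable def bestSuccess (M : Model Θ A Y X) (ε : ℝ) (n : ℕ) (h : Hist A Y n) : ℝ :=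
  ⨆ x, M.successProb ε n h x

/-- The joint law of the parameter and the history, given the history `h`. -/
noncomputable def givenHist (M : Model Θ A Y X) (n : ℕ) (h : Hist A Y n) :
    Measure (Θ × Hist A Y n) :=
  (M.posterior n h).prod (Measure.dirac h)

/-- The joint law of the parameter and the first observation. -/
noncomputable def start (M : Model Θ A Y X) : Measure (Θ × Hist A Y 0) :=
  (M.prior ⊗ₘ M.init).map (fun z => (z.1, (z.2, fun i => i.elim0)))

/-- The expected cost `𝔼[(number of queries after the first n) - lam * r(H_τ)]`. -/
noncomputable def cost (M : Model Θ A Y X) (ε lam : ℝ) (π : Policy A Y) (n : ℕ)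
    (μ : Measure (Θ × Hist A Y n)) : ℝ :=
  ∫ s, (((s.1 : ℝ) - n) - lam * M.bestSuccess ε s.1 s.2) ∂(M.stoppedLaw π n μ)

/-- The optimal cost-to-go `V⋆` from the history `h`. -/
noncomputable def value (M : Model Θ A Y X) (ε lam : ℝ) (n : ℕ) (h : Hist A Y n) : ℝ :=
  ⨅ π : {π : Policy A Y // M.Admissible π n (M.givenHist n h)},
    M.cost ε lam π.1 n (M.givenHist n h)

/-- The posterior predictive law of the next observation after the query `a`. -/
noncomputable def predictive (M : Model Θ A Y X) (n : ℕ) (h : Hist A Y n) (a : A) : Measure Y :=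
  (M.posterior n h).bind (fun θ => M.obs n (θ, h, a))

noncomputable def qStop (M : Model Θ A Y X) (ε lam : ℝ) (n : ℕ) (h : Hist A Y n) : ℝ :=
  -(lam * M.bestSuccess ε n h)

noncomputable def qCont (M : Model Θ A Y X) (ε lam : ℝ) (n : ℕ) (h : Hist A Y n) (a : A) : ℝ :=
  1 + lowerIntegral (M.predictive n h a) (fun y => M.value ε lam (n + 1) (h.append a y))

/-- For every parameter and history, the law of the next observation depends weakly continuously
on the query. -/
def WeaklyContinuous [TopologicalSpace A] [TopologicalSpace Y] (M : Model Θ A Y X) : Prop :=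
  ∀ (n : ℕ) (θ : Θ) (h : Hist A Y n) (f : Y →ᵇ ℝ),
    Continuous fun a => ∫ y, f y ∂(M.obs n (θ, h, a))

open Classical in
/-- `π` stops exactly when `Q_stop ≤ Q_cont(·, a⋆)`, and otherwise queries `a⋆`. -/
def FollowsActor (M : Model Θ A Y X) (ε lam : ℝ) (actor : ∀ n, Hist A Y n → A)
    (π : Policy A Y) : Prop :=
  ∀ n h, M.Regular n h →
    π.kern n h = if M.qStop ε lam n h ≤ M.qCont ε lam n h (actor n h)
      then Measure.dirac (Sum.inr ()) else Measure.dirac (Sum.inl (actor n h))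

end Model

end

end SeqTest

/-! Add the constant `lam` to the cost. Since `0 ≤ r ≤ 1`, stopping then costs `lam * (1 - r) ≥ 0`
and every query costs one, so the expected shifted cost is a series in `ℝ≥0∞` that makes sense for
every policy. Its finiteness is exactly admissibility (`admissible_iff`), and where it is finite it
is the expected cost plus `lam` (`cost_eq`).

Bayes' formula (`lintegral_posterior_obs`) lets the next observation be drawn from the predictive
law and the parameter afterwards from the updated posterior. Averaging over the posterior therefore
gives a recursion in the history alone (`histCost_eq`). The evidence is the density of the
predictive law, up to normalization, so a regular history is almost surely followed by a regular
one; this is (2), and irregular histories never matter.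

For (1), the difficulty is that `V⋆` is an infimum over policies, with no evident measurability and
no evident way to glue near-optimal continuations together. Value iteration along the actor avoids
both. The iterates `iterValue` start from zero, are measurable and increase. By induction they stay
below `V⋆ + lam`: an iterate is a measurable minorant, so its integral is below the lower integral
in `Q_cont`; the actor minimizes `Q_cont`; and `min (Q_stop, Q_cont)` bounds the cost of every
policy from below (`min_le_histCost`). Conversely, by monotone convergence the limit satisfies the
optimality equation, and the policy that follows it costs at most the limit, because each of its
truncated costs does (`lintegral_costUpTo_le`). Hence `V⋆ + lam` is the limit at regular histories
(`ofReal_value_eq`), and integrability, the Bellman equation and optimality follow. The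
measurability of `r`, a supremum over an uncountable set of decisions, comes from compactness
(`iSup_measure_sublevel_eq`).

For (3), Lipschitz minorants of the value reduce lower semicontinuity to weak continuity;
compactness of `A` then gives a minimizer. -/

namespace SeqTest

universe u₁ u₂ u₃ u₄

section

variable {Θ : Type u₁} {A : Type u₂} {Y : Type u₃} {X : Type u₄}
  [MeasurableSpace Θ] [MeasurableSpace A] [MeasurableSpace Y]

/-! ### Measurability of histories; stopping and continuing. -/

instance (M : Model Θ A Y X) : IsProbabilityMeasure M.prior := M.prior_prob
instance (M : Model Θ A Y X) : IsMarkovKernel M.init := M.init_markov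
instance (M : Model Θ A Y X) (n : ℕ) : IsMarkovKernel (M.obs n) := M.obs_markov n
instance (M : Model Θ A Y X) : IsProbabilityMeasure M.refInit := M.refInit_prob
instance (M : Model Θ A Y X) : IsProbabilityMeasure M.refObs := M.refObs_prob
instance (π : Policy A Y) (n : ℕ) : IsMarkovKernel (π.kern n) := π.markov n

theorem measurable_append (n : ℕ) :
    Measurable (fun z : Hist A Y n × (A × Y) => Hist.append z.1 z.2.1 z.2.2) := by
  unfold Hist.append
  refine Measurable.prodMk (by fun_prop) ?_
  refine measurable_pi_lambda _ fun i => ?_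
  induction i using Fin.lastCases with
  | last => simpa using measurable_snd
  | cast i => simp only [Fin.snoc_castSucc]; fun_prop

@[fun_prop]
theorem measurable_append_of_measurable {n : ℕ} {β : Type*} [MeasurableSpace β] {f : β → Hist A Y n}
    {a : β → A} {y : β → Y} (hf : Measurable f) (ha : Measurable a) (hy : Measurable y) :
    Measurable (fun b => Hist.append (f b) (a b) (y b)) :=
  (measurable_append n).comp (hf.prodMk (ha.prodMk hy))

@[fun_prop]
theorem measurable_before {n : ℕ} (i : Fin n) :
    Measurable (fun h : Hist A Y n => h.before i) := by
  unfold Hist.before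
  fun_prop

/-- The history that consists of the first observation. -/
def Hist.first (A : Type u₂) {Y : Type u₃} (y : Y) : Hist A Y 0 := (y, fun i => i.elim0)

@[fun_prop]
theorem measurable_first : Measurable (Hist.first A : Y → Hist A Y 0) := by
  unfold Hist.first
  refine measurable_id.prodMk (measurable_pi_lambda _ fun i => i.elim0)

instance (π : Policy A Y) (n : ℕ) : IsFiniteKernel (π.cont n) :=
  inferInstanceAs (IsFiniteKernel ((π.kern n).comapRight measurableEmbedding_query))

theorem Policy.cont_univ_add_stopProb (π : Policy A Y) (n : ℕ) (h : Hist A Y n) :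
    π.cont n h univ + π.kern n h {Sum.inr ()} = 1 := by
  rw [Policy.cont, Kernel.comapRight_apply' _ _ _ MeasurableSet.univ, image_univ,
    ← measure_union]
  · convert measure_univ (μ := π.kern n h)
    ext x
    rcases x with x | x <;> simp
  · simp
  · rw [← image_singleton]
    exact (measurableSet_singleton ()).inr_image

/-! ### Likelihoods, posteriors and predictive laws. -/

namespace Model

attribute [fun_prop] measurable_initDensity measurable_obsDensity

theorem lintegral_init (M : Model Θ A Y X) (θ : Θ) {F : Y → ℝ≥0∞} (hF : Measurable F) :
    ∫⁻ y, F y ∂(M.init θ) = ∫⁻ y, M.initDensity (θ, y) * F y ∂M.refInit := by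
  rw [M.init_eq, lintegral_withDensity_eq_lintegral_mul _
    (f := fun y => M.initDensity (θ, y)) (by fun_prop) hF]
  rfl

theorem lintegral_obs (M : Model Θ A Y X) (n : ℕ) (θ : Θ) (h : Hist A Y n) (a : A)
    {F : Y → ℝ≥0∞} (hF : Measurable F) :
    ∫⁻ y, F y ∂(M.obs n (θ, h, a)) = ∫⁻ y, M.obsDensity n (θ, h, a, y) * F y ∂M.refObs := by
  rw [M.obs_eq, lintegral_withDensity_eq_lintegral_mul _
    (f := fun y => M.obsDensity n (θ, h, a, y)) (by fun_prop) hF]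
  rfl

@[fun_prop]
theorem measurable_likelihood (M : Model Θ A Y X) (n : ℕ) :
    Measurable (fun z : Θ × Hist A Y n => M.likelihood n z.1 z.2) := by
  unfold likelihood
  refine (M.measurable_initDensity.comp (by fun_prop)).mul
    (Finset.measurable_prod _ fun i _ => (M.measurable_obsDensity i).comp ?_)
  fun_prop

theorem measurable_evidence (M : Model Θ A Y X) (n : ℕ) : Measurable (M.evidence n) :=
  Measurable.lintegral_prod_left' (M.measurable_likelihood n)

theorem measurableSet_regular (M : Model Θ A Y X) (n : ℕ) :
    MeasurableSet {h | M.Regular n h} :=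
  ((measurableSet_singleton 0).compl.inter (measurableSet_singleton ∞).compl).preimage
    (M.measurable_evidence n)

theorem likelihood_first (M : Model Θ A Y X) (θ : Θ) (y : Y) :
    M.likelihood 0 θ (Hist.first A y) = M.initDensity (θ, y) := by
  simp [likelihood, Hist.first]

theorem likelihood_append (M : Model Θ A Y X) (n : ℕ) (θ : Θ) (h : Hist A Y n) (a : A) (y : Y) :
    M.likelihood (n + 1) θ (h.append a y) =
      M.likelihood n θ h * M.obsDensity n (θ, h, a, y) := by
  have h1 : ∀ i : Fin n, (h.append a y).before i.castSucc = h.before i := by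
    intro i
    refine Prod.ext rfl (funext fun j => ?_)
    exact Fin.snoc_castSucc (α := fun _ => A × Y) (a, y) h.2 (Fin.castLE i.isLt.le j)
  have h2 : (h.append a y).before (Fin.last n) = h := by
    refine Prod.ext rfl (funext fun j => ?_)
    exact Fin.snoc_castSucc (α := fun _ => A × Y) (a, y) h.2 j
  have h3 : ∀ i : Fin n, (h.append a y).2 i.castSucc = h.2 i := fun i =>
    Fin.snoc_castSucc (α := fun _ => A × Y) (a, y) h.2 i
  have h4 : (h.append a y).2 (Fin.last n) = (a, y) :=
    Fin.snoc_last (α := fun _ => A × Y) (a, y) h.2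
  unfold likelihood
  rw [Fin.prod_univ_castSucc, ← mul_assoc]
  simp only [h3, h4]
  congr 1
  · congr 1
    refine Finset.prod_congr rfl fun i _ => ?_
    exact congrArg (fun b => M.obsDensity i (θ, b, (h.2 i).1, (h.2 i).2)) (h1 i)
  · exact congrArg (fun b => M.obsDensity n (θ, b, a, y)) h2

instance (M : Model Θ A Y X) (n : ℕ) (h : Hist A Y n) :
    IsProbabilityMeasure (M.posterior n h) := by
  unfold posterior
  split_ifs with hr
  · refine ⟨?_⟩
    simp only [Measure.smul_apply, MeasurableSet.univ, withDensity_apply, Measure.restrict_univ,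
      smul_eq_mul]
    exact ENNReal.inv_mul_cancel hr.1 hr.2
  · infer_instance

/-- When the evidence vanishes, so does the likelihood at almost every parameter, and both sides are
zero whatever the default posterior is. Only infinite evidence has to be excluded. -/
theorem lintegral_likelihood_mul (M : Model Θ A Y X) (n : ℕ) (h : Hist A Y n)
    (hh : M.evidence n h ≠ ∞) {F : Θ → ℝ≥0∞} (hF : Measurable F) :
    ∫⁻ θ, M.likelihood n θ h * F θ ∂M.prior
      = M.evidence n h * ∫⁻ θ, F θ ∂(M.posterior n h) := by
  have hm : Measurable (fun θ => M.likelihood n θ h) :=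
    (M.measurable_likelihood n).comp measurable_prodMk_right
  by_cases h0 : M.evidence n h = 0
  · rw [h0, zero_mul]
    have : (fun θ => M.likelihood n θ h) =ᵐ[M.prior] 0 := (lintegral_eq_zero_iff hm).1 h0
    refine (lintegral_eq_zero_iff (f := fun θ => M.likelihood n θ h * F θ) (by fun_prop)).2 ?_
    filter_upwards [this] with θ hθ
    simp_all
  · rw [posterior, if_pos ⟨h0, hh⟩, lintegral_smul_measure,
      lintegral_withDensity_eq_lintegral_mul _ hm hF, smul_eq_mul, ← mul_assoc,
      ENNReal.mul_inv_cancel h0 hh, one_mul]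
    rfl

open Classical in
/-- The posterior as a kernel. -/
noncomputable def posteriorKernel (M : Model Θ A Y X) (n : ℕ) : Kernel (Hist A Y n) Θ where
  toFun := M.posterior n
  measurable' := by
    refine Measure.measurable_of_measurable_coe _ fun s hs => ?_
    have : (fun h => M.posterior n h s) = fun h => {h | M.Regular n h}.piecewise
        (fun h => (M.evidence n h)⁻¹ * ∫⁻ θ in s, M.likelihood n θ h ∂M.prior)
        (fun _ => M.prior s) h := by
      funext h
      by_cases hr : M.Regular n h
      · rw [piecewise_eq_of_mem {h | M.Regular n h} _ _ hr, posterior, if_pos hr, Measure.smul_apply,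
          withDensity_apply _ hs, smul_eq_mul]
      · rw [piecewise_eq_of_notMem {h | M.Regular n h} _ _ hr, posterior, if_neg hr]
    rw [this]
    refine Measurable.piecewise (M.measurableSet_regular n) ?_ measurable_const
    exact (M.measurable_evidence n).inv.mul
      (Measurable.lintegral_prod_left' (M.measurable_likelihood n))

instance (M : Model Θ A Y X) (n : ℕ) : IsMarkovKernel (M.posteriorKernel n) :=
  ⟨fun h => inferInstanceAs (IsProbabilityMeasure (M.posterior n h))⟩

theorem measurable_lintegral_posterior (M : Model Θ A Y X) (n : ℕ) {β : Type*}
    [MeasurableSpace β] {g : β → Hist A Y n} (hg : Measurable g) {F : β × Θ → ℝ≥0∞}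
    (hF : Measurable F) : Measurable fun b => ∫⁻ θ, F (b, θ) ∂(M.posterior n (g b)) :=
  Measurable.lintegral_kernel_prod_right' (κ := (M.posteriorKernel n).comap g hg) hF

theorem measurable_lintegral_obs (M : Model Θ A Y X) (n : ℕ) {β : Type*}
    [MeasurableSpace β] {g : β → Θ × Hist A Y n × A} (hg : Measurable g) {F : β × Y → ℝ≥0∞}
    (hF : Measurable F) : Measurable fun b => ∫⁻ y, F (b, y) ∂(M.obs n (g b)) :=
  Measurable.lintegral_kernel_prod_right' (κ := (M.obs n).comap g hg) hF

theorem lintegral_predictive (M : Model Θ A Y X) (n : ℕ) (h : Hist A Y n) (a : A)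
    {F : Y → ℝ≥0∞} (hF : Measurable F) :
    ∫⁻ y, F y ∂(M.predictive n h a)
      = ∫⁻ θ, ∫⁻ y, F y ∂(M.obs n (θ, h, a)) ∂(M.posterior n h) := by
  rw [predictive, Measure.lintegral_bind _ hF.aemeasurable]
  exact ((M.obs n).measurable.comp (by fun_prop)).aemeasurable

/-- The posterior predictive law as a kernel. -/
noncomputable def predictiveKernel (M : Model Θ A Y X) (n : ℕ) :
    Kernel (Hist A Y n × A) Y where
  toFun z := M.predictive n z.1 z.2
  measurable' := by
    refine Measure.measurable_of_measurable_coe _ fun s hs => ?_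
    simp_rw [← lintegral_indicator_one hs,
      M.lintegral_predictive n _ _ (measurable_one.indicator hs), lintegral_indicator_one hs]
    exact M.measurable_lintegral_posterior n measurable_fst
      (F := fun z : (Hist A Y n × A) × Θ => M.obs n (z.2, z.1.1, z.1.2) s)
      (((M.obs n).measurable_coe hs).comp (by fun_prop))

instance (M : Model Θ A Y X) (n : ℕ) (h : Hist A Y n) (a : A) :
    IsProbabilityMeasure (M.predictive n h a) := by
  refine ⟨?_⟩
  rw [← lintegral_one, M.lintegral_predictive n h a measurable_const]
  simp

instance (M : Model Θ A Y X) (n : ℕ) : IsMarkovKernel (M.predictiveKernel n) :=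
  ⟨fun z => inferInstanceAs (IsProbabilityMeasure (M.predictive n z.1 z.2))⟩

theorem measurable_lintegral_predictive (M : Model Θ A Y X) (n : ℕ) {β : Type*}
    [MeasurableSpace β] {g : β → Hist A Y n} (hg : Measurable g) {a : β → A}
    (ha : Measurable a) {F : β × Y → ℝ≥0∞} (hF : Measurable F) :
    Measurable fun b => ∫⁻ y, F (b, y) ∂(M.predictive n (g b) (a b)) :=
  Measurable.lintegral_kernel_prod_right'
    (κ := (M.predictiveKernel n).comap (fun b => (g b, a b)) (hg.prodMk ha)) hF

/-- The prior predictive law of the first observation. -/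
noncomputable def firstLaw (M : Model Θ A Y X) : Measure Y := M.prior.bind M.init

theorem lintegral_firstLaw (M : Model Θ A Y X) {F : Y → ℝ≥0∞} (hF : Measurable F) :
    ∫⁻ y, F y ∂M.firstLaw = ∫⁻ θ, ∫⁻ y, F y ∂(M.init θ) ∂M.prior :=
  Measure.lintegral_bind M.init.measurable.aemeasurable hF.aemeasurable

/-- Tonelli: the evidence is the density of the prior predictive law. It is therefore almost
everywhere finite for the reference measure and almost surely nonzero under the predictive law. -/
theorem lintegral_firstLaw_eq (M : Model Θ A Y X) {F : Y → ℝ≥0∞} (hF : Measurable F) :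
    ∫⁻ y, F y ∂M.firstLaw
      = ∫⁻ y, M.evidence 0 (Hist.first A y) * F y ∂M.refInit := by
  rw [lintegral_firstLaw _ hF]
  simp_rw [M.lintegral_init _ hF]
  rw [lintegral_lintegral_swap
    ((M.measurable_initDensity.mul (hF.comp measurable_snd)).aemeasurable)]
  refine lintegral_congr fun y => ?_
  rw [lintegral_mul_const _ (f := fun θ => M.initDensity (θ, y)) (by fun_prop)]
  simp_rw [evidence, likelihood_first]

theorem evidence_first_ne_top (M : Model Θ A Y X) :
    ∀ᵐ y ∂M.refInit, M.evidence 0 (Hist.first A y) ≠ ∞ := by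
  refine (ae_lt_top ((M.measurable_evidence 0).comp measurable_first) ?_).mono
    fun y hy => hy.ne
  have := M.lintegral_firstLaw_eq (F := fun _ => 1) measurable_const
  rw [lintegral_firstLaw _ measurable_const] at this
  simp at this
  simp [← this]

theorem ae_regular_first (M : Model Θ A Y X) :
    ∀ᵐ y ∂M.firstLaw, M.Regular 0 (Hist.first A y) := by
  have hs : MeasurableSet {y : Y | M.Regular 0 (Hist.first A y)} :=
    measurable_first (M.measurableSet_regular 0)
  have hi : Measurable (indicator {y : Y | M.Regular 0 (Hist.first A y)}ᶜ (1 : Y → ℝ≥0∞)) :=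
    measurable_one.indicator hs.compl
  change M.firstLaw {y : Y | M.Regular 0 (Hist.first A y)}ᶜ = 0
  rw [← lintegral_indicator_one hs.compl, M.lintegral_firstLaw_eq hi]
  refine (lintegral_eq_zero_iff
    (((M.measurable_evidence 0).comp measurable_first).mul hi)).2 ?_
  filter_upwards [M.evidence_first_ne_top] with y hy
  by_cases h0 : M.evidence 0 (Hist.first A y) = 0
  · simp [h0]
  · simp [Regular, h0, hy]

theorem lintegral_start (M : Model Θ A Y X) {F : Θ × Hist A Y 0 → ℝ≥0∞} (hF : Measurable F) :
    ∫⁻ z, F z ∂M.start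
      = ∫⁻ y, ∫⁻ θ, F (θ, Hist.first A y) ∂(M.posterior 0 (Hist.first A y)) ∂M.firstLaw := by
  have hF' : Measurable fun z : Θ × Y => F (z.1, Hist.first A z.2) := hF.comp (by fun_prop)
  have hstart : M.start = (M.prior ⊗ₘ M.init).map (fun z => (z.1, Hist.first A z.2)) := rfl
  rw [hstart, lintegral_map hF (by fun_prop), Measure.lintegral_compProd hF',
    M.lintegral_firstLaw_eq (M.measurable_lintegral_posterior 0 measurable_first
      (F := fun z : Y × Θ => F (z.2, Hist.first A z.1)) (hF.comp (by fun_prop)))]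
  have e : ∀ θ, ∫⁻ y, F (θ, Hist.first A y) ∂M.init θ
      = ∫⁻ y, M.initDensity (θ, y) * F (θ, Hist.first A y) ∂M.refInit := fun θ =>
    M.lintegral_init θ (hF'.comp measurable_prodMk_left)
  simp_rw [e]
  rw [lintegral_lintegral_swap ((M.measurable_initDensity.mul hF').aemeasurable)]
  refine lintegral_congr_ae ?_
  filter_upwards [M.evidence_first_ne_top] with y hy
  rw [← M.lintegral_likelihood_mul 0 _ hy (F := fun θ => F (θ, Hist.first A y)) (by fun_prop)]
  simp_rw [likelihood_first]

/-- Again Tonelli: the predictive density is a ratio of successive evidences. The product form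
avoids the division. -/
theorem lintegral_evidence_append_mul (M : Model Θ A Y X) (n : ℕ) (h : Hist A Y n)
    (hh : M.Regular n h) (a : A) {F : Y → ℝ≥0∞} (hF : Measurable F) :
    M.evidence n h * ∫⁻ y, F y ∂(M.predictive n h a)
      = ∫⁻ y, M.evidence (n + 1) (h.append a y) * F y ∂M.refObs := by
  have hd : Measurable fun z : Θ × Y => M.obsDensity n (z.1, h, a, z.2) :=
    (M.measurable_obsDensity n).comp (by fun_prop)
  have hl : Measurable fun θ => M.likelihood n θ h :=
    (M.measurable_likelihood n).comp measurable_prodMk_right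
  rw [M.lintegral_predictive n h a hF, ← M.lintegral_likelihood_mul n h hh.2
    (M.measurable_lintegral_obs n (g := fun θ => (θ, h, a)) (by fun_prop)
      (F := fun z => F z.2) (by fun_prop))]
  simp_rw [M.lintegral_obs n _ _ _ hF]
  have : ∀ θ, M.likelihood n θ h * ∫⁻ y, M.obsDensity n (θ, h, a, y) * F y ∂M.refObs
      = ∫⁻ y, M.likelihood n θ h * M.obsDensity n (θ, h, a, y) * F y ∂M.refObs := by
    intro θ
    rw [← lintegral_const_mul _ (f := fun y => M.obsDensity n (θ, h, a, y) * F y)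
      (by fun_prop)]
    simp_rw [mul_assoc]
  simp_rw [this]
  rw [lintegral_lintegral_swap
    ((((hl.comp measurable_fst).mul hd).mul (hF.comp measurable_snd)).aemeasurable)]
  refine lintegral_congr fun y => ?_
  rw [lintegral_mul_const _
    (f := fun θ => M.likelihood n θ h * M.obsDensity n (θ, h, a, y)) (by fun_prop)]
  simp_rw [evidence, likelihood_append]

theorem measurable_evidence_append (M : Model Θ A Y X) (n : ℕ) (h : Hist A Y n) (a : A) :
    Measurable fun y => M.evidence (n + 1) (h.append a y) :=
  (M.measurable_evidence (n + 1)).comp (by fun_prop)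

theorem evidence_append_ne_top (M : Model Θ A Y X) (n : ℕ) (h : Hist A Y n)
    (hh : M.Regular n h) (a : A) :
    ∀ᵐ y ∂M.refObs, M.evidence (n + 1) (h.append a y) ≠ ∞ := by
  refine (ae_lt_top (M.measurable_evidence_append n h a) ?_).mono fun y hy => hy.ne
  have := M.lintegral_evidence_append_mul n h hh a (F := fun _ => 1) measurable_const
  simp only [lintegral_const, measure_univ, mul_one] at this
  rw [← this]
  exact hh.2

theorem ae_regular_append (M : Model Θ A Y X) (n : ℕ) (h : Hist A Y n) (hh : M.Regular n h)
    (a : A) : ∀ᵐ y ∂(M.predictive n h a), M.Regular (n + 1) (h.append a y) := by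
  have hs : MeasurableSet {y : Y | M.Regular (n + 1) (h.append a y)} :=
    (M.measurableSet_regular (n + 1)).preimage (by fun_prop)
  have h1 := M.lintegral_evidence_append_mul n h hh a (measurable_one.indicator hs.compl)
  have h2 : ∫⁻ y, M.evidence (n + 1) (h.append a y) *
      {y : Y | M.Regular (n + 1) (h.append a y)}ᶜ.indicator 1 y ∂M.refObs = 0 := by
    refine (lintegral_eq_zero_iff ((M.measurable_evidence_append n h a).mul
      (measurable_one.indicator hs.compl))).2 ?_
    filter_upwards [M.evidence_append_ne_top n h hh a] with y hy
    by_cases h0 : M.evidence (n + 1) (h.append a y) = 0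
    · simp [h0]
    · simp [Regular, h0, hy]
  rw [h2, lintegral_indicator_one hs.compl] at h1
  exact (mul_eq_zero.1 h1).resolve_left hh.1

/-- Bayes' formula: the parameter and the next observation may be drawn in either order. -/
theorem lintegral_posterior_obs (M : Model Θ A Y X) (n : ℕ) (h : Hist A Y n)
    (hh : M.Regular n h) (a : A) {F : Θ × Y → ℝ≥0∞} (hF : Measurable F) :
    ∫⁻ θ, ∫⁻ y, F (θ, y) ∂(M.obs n (θ, h, a)) ∂(M.posterior n h)
      = ∫⁻ y, ∫⁻ θ, F (θ, y) ∂(M.posterior (n + 1) (h.append a y)) ∂(M.predictive n h a) := by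
  have hd : Measurable fun z : Θ × Y => M.obsDensity n (z.1, h, a, z.2) :=
    (M.measurable_obsDensity n).comp (by fun_prop)
  have hl : Measurable fun θ => M.likelihood n θ h :=
    (M.measurable_likelihood n).comp measurable_prodMk_right
  -- After multiplication by the evidence, positive and finite by regularity, both sides become the
  -- integral of likelihood times density times `F` against prior and reference measure.
  refine (ENNReal.mul_right_inj hh.1 hh.2).1 ?_
  rw [M.lintegral_evidence_append_mul n h hh a
      (M.measurable_lintegral_posterior (n + 1) (g := fun y => h.append a y) (by fun_prop)
        (F := fun z : Y × Θ => F (z.2, z.1)) (by fun_prop)),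
    ← M.lintegral_likelihood_mul n h hh.2
      (M.measurable_lintegral_obs n (g := fun θ => (θ, h, a)) (by fun_prop) hF)]
  have e : ∀ θ, ∫⁻ y, F (θ, y) ∂M.obs n (θ, h, a)
      = ∫⁻ y, M.obsDensity n (θ, h, a, y) * F (θ, y) ∂M.refObs := fun θ =>
    M.lintegral_obs n θ h a (hF.comp measurable_prodMk_left)
  have : ∀ θ, M.likelihood n θ h * ∫⁻ y, M.obsDensity n (θ, h, a, y) * F (θ, y) ∂M.refObs
      = ∫⁻ y, M.likelihood n θ h * M.obsDensity n (θ, h, a, y) * F (θ, y) ∂M.refObs := by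
    intro θ
    rw [← lintegral_const_mul _ (f := fun y => M.obsDensity n (θ, h, a, y) * F (θ, y))
      (by fun_prop)]
    simp_rw [mul_assoc]
  simp_rw [e, this]
  rw [lintegral_lintegral_swap ((((hl.comp measurable_fst).mul hd).mul hF).aemeasurable)]
  refine lintegral_congr_ae ?_
  filter_upwards [M.evidence_append_ne_top n h hh a] with y hy
  rw [← M.lintegral_likelihood_mul (n + 1) _ hy (F := fun θ => F (θ, y)) (by fun_prop)]
  simp_rw [likelihood_append]

end Model

/-! ### The tail-sum formula for an expectation. -/

section Tail

variable {p m : ℕ → ℝ≥0∞}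

/-- In the application, `p k` is the probability of stopping after exactly `k` further queries, and
`m k` that of making at least `k`. -/
theorem sum_range_add_tail (h0 : m 0 = 1) (h : ∀ k, p k + m (k + 1) = m k) (N : ℕ) :
    ∑ k ∈ Finset.range N, p k + m N = 1 := by
  induction N with
  | zero => simpa using h0
  | succ N ih => rw [Finset.sum_range_succ, add_assoc, h, ih]

/-- Summable tails tend to zero, so no mass escapes to infinity. -/
theorem tsum_eq_one_of_tsum_tail_ne_top (h0 : m 0 = 1) (h : ∀ k, p k + m (k + 1) = m k)
    (hm : ∑' k, m (k + 1) ≠ ∞) : ∑' k, p k = 1 := by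
  have h1 : Filter.Tendsto m Filter.atTop (nhds 0) :=
    (Filter.tendsto_add_atTop_iff_nat 1).1 (ENNReal.tendsto_atTop_zero_of_tsum_ne_top hm)
  have h2 := (ENNReal.tendsto_nat_tsum p).add h1
  simp only [sum_range_add_tail h0 h, add_zero] at h2
  exact tendsto_nhds_unique h2 tendsto_const_nhds

theorem tsum_mul_eq_tsum_tail (h0 : m 0 = 1) (h : ∀ k, p k + m (k + 1) = m k)
    (hp : ∑' k, p k = 1) : ∑' k : ℕ, (k : ℝ≥0∞) * p k = ∑' k, m (k + 1) := by
  have hm : ∀ N, m N = ∑' k, p (k + N) := by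
    intro N
    have h1 := sum_range_add_tail h0 h N
    have h2 := ENNReal.summable.sum_add_tsum_nat_add' (f := p) (k := N)
    rw [hp] at h2
    have h3 : ∑ k ∈ Finset.range N, p k ≠ ∞ := by
      intro h4
      rw [h4] at h1
      simp at h1
    exact (ENNReal.add_right_inj h3).1 (h1.trans h2.symm)
  have h1 : ∀ j, m (j + 1) = ∑' k, if j < k then p k else 0 := by
    intro j
    have h2 := ENNReal.summable.sum_add_tsum_nat_add'
      (f := fun k => if j < k then p k else 0) (k := j + 1)
    rw [Finset.sum_eq_zero, zero_add] at h2
    · rw [hm, ← h2]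
      refine tsum_congr fun k => ?_
      rw [if_pos (by omega)]
    · intro k hk
      rw [if_neg (by simp at hk; omega)]
  simp_rw [h1]
  rw [ENNReal.tsum_comm]
  refine tsum_congr fun k => ?_
  rw [tsum_eq_sum (s := Finset.range k)]
  · rw [Finset.sum_congr rfl (g := fun _ => p k)]
    · simp
    · intro j hj
      rw [if_pos (by simpa using hj)]
  · intro j hj
    rw [if_neg (by simpa using hj)]

end Tail

/-! ### Measurability on a disjoint union. -/

section Sigma

variable {ι : Type*} {β : ι → Type*} [∀ i, MeasurableSpace (β i)]

theorem measurable_sigma_mk (i : ι) : Measurable (Sigma.mk i : β i → Σ i, β i) := by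
  intro s hs
  exact (MeasurableSpace.measurableSet_iInf.1 hs) i

theorem measurable_of_sigma {γ : Type*} [MeasurableSpace γ] {f : (Σ i, β i) → γ}
    (h : ∀ i, Measurable fun b => f ⟨i, b⟩) : Measurable f := by
  intro s hs
  exact MeasurableSpace.measurableSet_iInf.2 fun i => h i hs

end Sigma

/-! ### The law of a run and the shifted cost as a series. -/

namespace Model

variable (M : Model Θ A Y X)

theorem lintegral_step (π : Policy A Y) (n : ℕ) (θ : Θ) (h : Hist A Y n)
    {F : Θ × Hist A Y (n + 1) → ℝ≥0∞} (hF : Measurable F) :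
    ∫⁻ z, F z ∂(M.step π n (θ, h))
      = ∫⁻ a, ∫⁻ y, F (θ, h.append a y) ∂(M.obs n (θ, h, a)) ∂(π.cont n h) := by
  have hF1 : Measurable fun z : (Θ × Hist A Y n) × (A × Y) =>
    F (z.1.1, Hist.append z.1.2 z.2.1 z.2.2) := hF.comp (measurable_append_aux n)
  rw [step, Kernel.lintegral_map _ (measurable_append_aux n) _ hF,
    Kernel.lintegral_prod _ _ _ hF1, Kernel.id_apply,
    lintegral_dirac' _ (Measurable.lintegral_prod_right' hF1),
    Kernel.lintegral_compProd _ _ _ (f := fun z : A × Y => F (θ, h.append z.1 z.2))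
      (by fun_prop)]
  rfl

/-- The expectation of `F` after one more query. -/
noncomputable def next (π : Policy A Y) (F : ∀ n, Θ × Hist A Y n → ℝ≥0∞) :
    ∀ n, Θ × Hist A Y n → ℝ≥0∞ :=
  fun n z => ∫⁻ z', F (n + 1) z' ∂(M.step π n z)

variable {M} in
theorem measurable_next {π : Policy A Y} {F : ∀ n, Θ × Hist A Y n → ℝ≥0∞}
    (hF : ∀ n, Measurable (F n)) (n : ℕ) : Measurable (M.next π F n) :=
  (hF (n + 1)).lintegral_kernel

variable {M} in
theorem measurable_next_iterate {π : Policy A Y} {F : ∀ n, Θ × Hist A Y n → ℝ≥0∞}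
    (hF : ∀ n, Measurable (F n)) (k n : ℕ) : Measurable ((M.next π)^[k] F n) := by
  induction k generalizing n with
  | zero => exact hF n
  | succ k ih =>
    rw [Function.iterate_succ_apply']
    exact measurable_next ih n

/-- Letting `next` act on families indexed by all history lengths turns the law of a run into an
iterated operator, so that no identification of `n + 1 + k` with `n + (k + 1)` is ever needed. -/
theorem lintegral_run (π : Policy A Y) {F : ∀ n, Θ × Hist A Y n → ℝ≥0∞}
    (hF : ∀ n, Measurable (F n)) (n k : ℕ) (z : Θ × Hist A Y n) :
    ∫⁻ z', F (n + k) z' ∂(M.run π n k z) = (M.next π)^[k] F n z := by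
  induction k generalizing F with
  | zero => exact (lintegral_dirac' z (hF n))
  | succ k ih =>
    rw [Function.iterate_succ_apply, ← ih (measurable_next hF)]
    exact Kernel.lintegral_comp _ _ _ (hF (n + k + 1))

/-- The law of the parameter and the history after `k` further queries. -/
noncomputable def lawAfter (π : Policy A Y) (n : ℕ) (μ : Measure (Θ × Hist A Y n)) (k : ℕ) :
    Measure (Θ × Hist A Y (n + k)) := μ.bind (M.run π n k)

theorem lintegral_lawAfter (π : Policy A Y) {F : ∀ n, Θ × Hist A Y n → ℝ≥0∞}
    (hF : ∀ n, Measurable (F n)) (n k : ℕ) (μ : Measure (Θ × Hist A Y n)) :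
    ∫⁻ z, F (n + k) z ∂(M.lawAfter π n μ k) = ∫⁻ z, (M.next π)^[k] F n z ∂μ := by
  rw [lawAfter, Measure.lintegral_bind (M.run π n k).measurable.aemeasurable
    (hF _).aemeasurable]
  simp_rw [M.lintegral_run π hF]

@[fun_prop]
theorem _root_.SeqTest.Policy.measurable_stopProb (π : Policy A Y) (n : ℕ) :
    Measurable fun h : Hist A Y n => π.kern n h {Sum.inr ()} := by
  refine (π.kern n).measurable_coe ?_
  rw [← image_singleton]
  exact (measurableSet_singleton ()).inr_image

@[fun_prop]
theorem _root_.SeqTest.Policy.measurable_cont_univ (π : Policy A Y) (n : ℕ) :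
    Measurable fun h : Hist A Y n => π.cont n h univ :=
  (π.cont n).measurable_coe MeasurableSet.univ

theorem next_one (π : Policy A Y) (n : ℕ) (z : Θ × Hist A Y n) :
    M.next π (fun _ _ => 1) n z = π.cont n z.2 univ := by
  rw [next, ← Prod.mk.eta (p := z), M.lintegral_step π n _ _ measurable_const]
  simp

theorem lawAfter_zero_univ (π : Policy A Y) (n : ℕ) (μ : Measure (Θ × Hist A Y n))
    [IsProbabilityMeasure μ] : M.lawAfter π n μ 0 univ = 1 := by
  rw [← lintegral_one, M.lintegral_lawAfter π (F := fun _ _ => 1) (fun _ => measurable_const)]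
  simp

theorem lawAfter_succ_univ (π : Policy A Y) (n : ℕ) (μ : Measure (Θ × Hist A Y n)) (k : ℕ) :
    M.lawAfter π n μ (k + 1) univ = ∫⁻ z, π.cont (n + k) z.2 univ ∂(M.lawAfter π n μ k) := by
  rw [M.lintegral_lawAfter π (F := fun n z => π.cont n z.2 univ) (fun n => by fun_prop),
    ← lintegral_one, M.lintegral_lawAfter π (F := fun _ _ => 1) (fun _ => measurable_const)]
  simp_rw [Function.iterate_succ_apply]
  congr! with z
  exact M.next_one π _ _

theorem stop_add_lawAfter_succ (π : Policy A Y) (n : ℕ) (μ : Measure (Θ × Hist A Y n)) (k : ℕ) :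
    ∫⁻ z, π.kern (n + k) z.2 {Sum.inr ()} ∂(M.lawAfter π n μ k) + M.lawAfter π n μ (k + 1) univ
      = M.lawAfter π n μ k univ := by
  rw [lawAfter_succ_univ, ← lintegral_add_left (by fun_prop), ← lintegral_one]
  refine lintegral_congr fun z => ?_
  rw [add_comm, π.cont_univ_add_stopProb]

theorem lintegral_stoppedLaw (π : Policy A Y) (n : ℕ) (μ : Measure (Θ × Hist A Y n))
    {f : (Σ m, Hist A Y m) → ℝ≥0∞} (hf : ∀ m, Measurable fun h => f ⟨m, h⟩) :
    ∫⁻ s, f s ∂(M.stoppedLaw π n μ)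
      = ∑' k, ∫⁻ z, π.kern (n + k) z.2 {Sum.inr ()} * f ⟨n + k, z.2⟩
          ∂(M.lawAfter π n μ k) := by
  rw [stoppedLaw, lintegral_sum_measure]
  refine tsum_congr fun k => ?_
  rw [lintegral_map (measurable_of_sigma hf) (measurable_sigma_mk _),
    lintegral_withDensity_eq_lintegral_mul _ (π.measurable_stopProb _) (hf _),
    lintegral_map ((π.measurable_stopProb _).mul (hf _)) measurable_snd]
  rfl

theorem bestSuccess_nonneg (ε : ℝ) (n : ℕ) (h : Hist A Y n) : 0 ≤ M.bestSuccess ε n h :=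
  Real.iSup_nonneg fun _ => measureReal_nonneg

theorem bestSuccess_le_one (ε : ℝ) (n : ℕ) (h : Hist A Y n) : M.bestSuccess ε n h ≤ 1 :=
  Real.iSup_le (fun _ => measureReal_le_one) zero_le_one

/-- The cost of stopping, shifted by `lam` to make it nonnegative. -/
noncomputable def stopCost (ε lam : ℝ) (n : ℕ) (h : Hist A Y n) : ℝ≥0∞ :=
  ENNReal.ofReal (M.qStop ε lam n h + lam)

variable {ε lam : ℝ}

theorem qStop_add_nonneg (hlam : 0 ≤ lam) (n : ℕ) (h : Hist A Y n) :
    0 ≤ M.qStop ε lam n h + lam := by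
  rw [qStop]
  nlinarith [M.bestSuccess_le_one ε n h]

theorem qStop_nonpos (hlam : 0 ≤ lam) (n : ℕ) (h : Hist A Y n) : M.qStop ε lam n h ≤ 0 := by
  rw [qStop]
  nlinarith [M.bestSuccess_nonneg ε n h]

theorem stopCost_le (hlam : 0 ≤ lam) (n : ℕ) (h : Hist A Y n) :
    M.stopCost ε lam n h ≤ ENNReal.ofReal lam :=
  ENNReal.ofReal_le_ofReal (by linarith [M.qStop_nonpos (ε := ε) hlam n h])

theorem measurable_stopCost (hr : ∀ n, Measurable (M.bestSuccess (A := A) (Y := Y) ε n))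
    (n : ℕ) : Measurable (M.stopCost ε lam n) :=
  (((hr n).const_mul lam).neg.add_const lam).ennreal_ofReal

/-- The expected cost of the current decision, shifted by `lam` on stopping. -/
noncomputable def stageCost (ε lam : ℝ) (π : Policy A Y) (n : ℕ) (z : Θ × Hist A Y n) : ℝ≥0∞ :=
  π.cont n z.2 univ + π.kern n z.2 {Sum.inr ()} * M.stopCost ε lam n z.2

theorem measurable_stageCost (hr : ∀ n, Measurable (M.bestSuccess (A := A) (Y := Y) ε n))
    (π : Policy A Y) (n : ℕ) : Measurable (M.stageCost ε lam π n) := by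
  have := M.measurable_stopCost (lam := lam) hr n
  unfold stageCost
  fun_prop

/-- The expected cost of the first `N` decisions, shifted by `lam` on stopping. -/
noncomputable def costUpTo (ε lam : ℝ) (π : Policy A Y) (N n : ℕ) (z : Θ × Hist A Y n) : ℝ≥0∞ :=
  ∑ k ∈ Finset.range N, (M.next π)^[k] (M.stageCost ε lam π) n z

/-- The expected cost, shifted by `lam`, with infinite cost assigned to not stopping. -/
noncomputable def totalCost (ε lam : ℝ) (π : Policy A Y) (n : ℕ) (z : Θ × Hist A Y n) : ℝ≥0∞ :=
  ∑' k, (M.next π)^[k] (M.stageCost ε lam π) n z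

theorem measurable_totalCost (hr : ∀ n, Measurable (M.bestSuccess (A := A) (Y := Y) ε n))
    (π : Policy A Y) (n : ℕ) : Measurable (M.totalCost ε lam π n) :=
  Measurable.tsum fun k => measurable_next_iterate (M.measurable_stageCost hr π) k n

theorem measurable_costUpTo (hr : ∀ n, Measurable (M.bestSuccess (A := A) (Y := Y) ε n))
    (π : Policy A Y) (N n : ℕ) : Measurable (M.costUpTo ε lam π N n) :=
  Finset.measurable_fun_sum _ fun k _ => measurable_next_iterate (M.measurable_stageCost hr π) k n

theorem next_tsum {π : Policy A Y} {F : ℕ → ∀ n, Θ × Hist A Y n → ℝ≥0∞}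
    (hF : ∀ k n, Measurable (F k n)) (n : ℕ) (z : Θ × Hist A Y n) :
    M.next π (fun n z => ∑' k, F k n z) n z = ∑' k, M.next π (F k) n z :=
  lintegral_tsum fun k => (hF k (n + 1)).aemeasurable

theorem totalCost_eq (hr : ∀ n, Measurable (M.bestSuccess (A := A) (Y := Y) ε n))
    (π : Policy A Y) (n : ℕ) (z : Θ × Hist A Y n) :
    M.totalCost ε lam π n z
      = M.stageCost ε lam π n z + M.next π (M.totalCost ε lam π) n z := by
  rw [totalCost, tsum_eq_zero_add' ENNReal.summable]
  simp_rw [Function.iterate_succ_apply']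
  rw [← M.next_tsum (fun k => measurable_next_iterate (M.measurable_stageCost hr π) k)]
  rfl

theorem costUpTo_succ (hr : ∀ n, Measurable (M.bestSuccess (A := A) (Y := Y) ε n))
    (π : Policy A Y) (N n : ℕ) (z : Θ × Hist A Y n) :
    M.costUpTo ε lam π (N + 1) n z
      = M.stageCost ε lam π n z + M.next π (M.costUpTo ε lam π N) n z := by
  rw [costUpTo, Finset.sum_range_succ', add_comm]
  simp_rw [Function.iterate_succ_apply']
  congr 1
  exact (lintegral_finsetSum _ fun k _ =>
    measurable_next_iterate (M.measurable_stageCost hr π) k (n + 1)).symm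

theorem totalCost_eq_iSup (π : Policy A Y) (n : ℕ) (z : Θ × Hist A Y n) :
    M.totalCost ε lam π n z = ⨆ N, M.costUpTo ε lam π N n z :=
  ENNReal.tsum_eq_iSup_nat

/-- The continuing part of stage `k` contributes the probability of making at least `k + 1` queries;
these tails add up to the expected number of queries once stopping is almost sure. -/
theorem lintegral_totalCost (hr : ∀ n, Measurable (M.bestSuccess (A := A) (Y := Y) ε n))
    (π : Policy A Y) (n : ℕ) (μ : Measure (Θ × Hist A Y n)) :
    ∫⁻ z, M.totalCost ε lam π n z ∂μ
      = ∑' k, M.lawAfter π n μ (k + 1) univ +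
        ∑' k, ∫⁻ z, π.kern (n + k) z.2 {Sum.inr ()} * M.stopCost ε lam (n + k) z.2
          ∂(M.lawAfter π n μ k) := by
  unfold totalCost
  rw [lintegral_tsum fun k =>
      (measurable_next_iterate (M.measurable_stageCost hr π) k n).aemeasurable,
    ← ENNReal.tsum_add]
  refine tsum_congr fun k => ?_
  rw [← M.lintegral_lawAfter π (M.measurable_stageCost hr π), lawAfter_succ_univ,
    ← lintegral_add_left (by fun_prop)]
  rfl

theorem tsum_stop_mul_stopCost_le (hlam : 0 ≤ lam) (π : Policy A Y) (n : ℕ)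
    (μ : Measure (Θ × Hist A Y n)) :
    ∑' k, ∫⁻ z, π.kern (n + k) z.2 {Sum.inr ()} * M.stopCost ε lam (n + k) z.2
        ∂(M.lawAfter π n μ k)
      ≤ (∑' k, ∫⁻ z, π.kern (n + k) z.2 {Sum.inr ()} ∂(M.lawAfter π n μ k))
        * ENNReal.ofReal lam := by
  rw [← ENNReal.tsum_mul_right]
  refine ENNReal.tsum_le_tsum fun k => ?_
  rw [← lintegral_mul_const _ (by fun_prop)]
  refine lintegral_mono fun z => ?_
  gcongr
  exact M.stopCost_le hlam _ _

theorem stoppedLaw_univ (π : Policy A Y) (n : ℕ) (μ : Measure (Θ × Hist A Y n)) :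
    M.stoppedLaw π n μ univ
      = ∑' k, ∫⁻ z, π.kern (n + k) z.2 {Sum.inr ()} ∂(M.lawAfter π n μ k) := by
  rw [← lintegral_one, M.lintegral_stoppedLaw π n μ (fun _ => measurable_const)]
  simp

theorem measurable_sigma_fst : Measurable fun s : Σ m, Hist A Y m => (s.1 : ℝ) :=
  measurable_of_sigma fun m => measurable_const (a := (m : ℝ))

theorem integrable_fst_iff (π : Policy A Y) (n : ℕ) (μ : Measure (Θ × Hist A Y n)) :
    Integrable (fun s : Σ m, Hist A Y m => (s.1 : ℝ)) (M.stoppedLaw π n μ) ↔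
      ∑' k, ((n : ℝ≥0∞) + k) * ∫⁻ z, π.kern (n + k) z.2 {Sum.inr ()} ∂(M.lawAfter π n μ k)
        ≠ ∞ := by
  rw [Integrable, and_iff_right measurable_sigma_fst.aestronglyMeasurable,
    hasFiniteIntegral_iff_ofReal (Filter.Eventually.of_forall fun s => Nat.cast_nonneg _),
    M.lintegral_stoppedLaw π n μ (f := fun s => ENNReal.ofReal s.1)
      (fun m => measurable_const (a := ENNReal.ofReal m)),
    lt_top_iff_ne_top]
  have : ∀ k, ∫⁻ z, π.kern (n + k) z.2 {Sum.inr ()} * ENNReal.ofReal ((n + k : ℕ) : ℝ)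
      ∂(M.lawAfter π n μ k)
      = ((n : ℝ≥0∞) + k) * ∫⁻ z, π.kern (n + k) z.2 {Sum.inr ()} ∂(M.lawAfter π n μ k) := by
    intro k
    rw [lintegral_mul_const _ (by fun_prop), mul_comm, ENNReal.ofReal_natCast]
    push_cast
    rfl
  simp_rw [this]

/-- Stopping costs at most `lam` in total, so finiteness only concerns the sum of the tails. A
finite sum forces almost sure stopping and is then the expected number of queries. -/
theorem admissible_iff (hr : ∀ n, Measurable (M.bestSuccess (A := A) (Y := Y) ε n))
    (hlam : 0 ≤ lam) (π : Policy A Y) (n : ℕ) (μ : Measure (Θ × Hist A Y n))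
    [IsProbabilityMeasure μ] :
    M.Admissible π n μ ↔ ∫⁻ z, M.totalCost ε lam π n z ∂μ ≠ ∞ := by
  rw [Admissible, integrable_fst_iff, stoppedLaw_univ, M.lintegral_totalCost hr]
  have h0 := M.lawAfter_zero_univ π n μ
  have h1 := M.stop_add_lawAfter_succ π n μ
  have h2 := M.tsum_stop_mul_stopCost_le (ε := ε) hlam π n μ
  constructor
  · rintro ⟨hp, hi⟩
    rw [hp, one_mul] at h2
    refine ENNReal.add_ne_top.2 ⟨?_, ne_top_of_le_ne_top ENNReal.ofReal_ne_top h2⟩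
    rw [← tsum_mul_eq_tsum_tail (m := fun k => M.lawAfter π n μ k univ) h0 h1 hp]
    refine ne_top_of_le_ne_top hi (ENNReal.tsum_le_tsum fun k => ?_)
    gcongr
    exact le_add_self
  · intro hi
    have hm := (ENNReal.add_ne_top.1 hi).1
    have hp := tsum_eq_one_of_tsum_tail_ne_top (m := fun k => M.lawAfter π n μ k univ) h0 h1 hm
    refine ⟨hp, ?_⟩
    simp_rw [add_mul]
    rw [ENNReal.tsum_add, ENNReal.tsum_mul_left, hp,
      tsum_mul_eq_tsum_tail (m := fun k => M.lawAfter π n μ k univ) h0 h1 hp]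
    exact ENNReal.add_ne_top.2 ⟨by simp, hm⟩

theorem cost_eq (hr : ∀ n, Measurable (M.bestSuccess (A := A) (Y := Y) ε n))
    (hlam : 0 ≤ lam) (π : Policy A Y) (n : ℕ) (μ : Measure (Θ × Hist A Y n))
    [IsProbabilityMeasure μ] (hπ : M.Admissible π n μ) :
    M.cost ε lam π n μ = (∫⁻ z, M.totalCost ε lam π n z ∂μ).toReal - lam := by
  have h0 := M.lawAfter_zero_univ π n μ
  have h1 := M.stop_add_lawAfter_succ π n μ
  have hp := hπ.1
  have : IsProbabilityMeasure (M.stoppedLaw π n μ) := ⟨hp⟩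
  rw [stoppedLaw_univ] at hp
  -- This makes the truncated subtraction `s.1 - n` below agree with the real one.
  have hn : ∀ᵐ s ∂(M.stoppedLaw π n μ), n ≤ s.1 := by
    have hs : MeasurableSet {s : Σ m, Hist A Y m | n ≤ s.1} :=
      (measurable_of_sigma (f := fun s : Σ m, Hist A Y m => s.1) fun _ => measurable_const)
        measurableSet_Ici
    change M.stoppedLaw π n μ {s : Σ m, Hist A Y m | n ≤ s.1}ᶜ = 0
    rw [← lintegral_indicator_one hs.compl, M.lintegral_stoppedLaw π n μ
      (fun m => (measurable_one.indicator hs.compl).comp (measurable_sigma_mk m))]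
    simp
  have hrm : Measurable fun s : Σ m, Hist A Y m => M.bestSuccess ε s.1 s.2 :=
    measurable_of_sigma fun m => hr m
  have hri : Integrable (fun s : Σ m, Hist A Y m => M.bestSuccess ε s.1 s.2)
      (M.stoppedLaw π n μ) :=
    Integrable.of_bound hrm.aestronglyMeasurable 1 (Filter.Eventually.of_forall fun s => by
      rw [Real.norm_eq_abs, abs_of_nonneg (M.bestSuccess_nonneg _ _ _)]
      exact M.bestSuccess_le_one _ _ _)
  have hi : Integrable (fun s : Σ m, Hist A Y m =>
      ((s.1 : ℝ) - n) - lam * M.bestSuccess ε s.1 s.2) (M.stoppedLaw π n μ) :=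
    (hπ.2.sub (integrable_const _)).sub (hri.const_mul lam)
  have h2 : M.cost ε lam π n μ + lam = ∫ s, ((s.1 : ℝ) - n) + (M.qStop ε lam s.1 s.2 + lam)
      ∂(M.stoppedLaw π n μ) := by
    have h3 := integral_add hi (integrable_const lam)
    rw [integral_const, probReal_univ, one_smul] at h3
    rw [cost, ← h3]
    refine integral_congr_ae (Filter.Eventually.of_forall fun s => ?_)
    simp only [qStop]
    ring
  rw [eq_sub_iff_add_eq, h2, integral_eq_lintegral_of_nonneg_ae]
  · congr 1
    rw [lintegral_congr_ae (g := fun s : Σ m, Hist A Y m =>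
      ((s.1 - n : ℕ) : ℝ≥0∞) + M.stopCost ε lam s.1 s.2)]
    · rw [M.lintegral_stoppedLaw π n μ (f := fun s : Σ m, Hist A Y m =>
        ((s.1 - n : ℕ) : ℝ≥0∞) + M.stopCost ε lam s.1 s.2)
        (fun m => (M.measurable_stopCost hr m).const_add ((m - n : ℕ) : ℝ≥0∞)),
        M.lintegral_totalCost hr, 
        ← tsum_mul_eq_tsum_tail (m := fun k => M.lawAfter π n μ k univ) h0 h1 hp, ← ENNReal.tsum_add]
      refine tsum_congr fun k => ?_
      simp_rw [mul_add]
      rw [lintegral_add_left (by fun_prop), lintegral_mul_const _ (by fun_prop), mul_comm,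
        Nat.add_sub_cancel_left]
    · filter_upwards [hn] with s hs
      rw [ENNReal.ofReal_add (by simpa using hs) (M.qStop_add_nonneg hlam _ _),
        ← ENNReal.ofReal_natCast, Nat.cast_sub hs]
      rfl
  · filter_upwards [hn] with s hs
    exact add_nonneg (by simpa using hs) (M.qStop_add_nonneg hlam _ _)
  · refine (Measurable.add ?_ ?_).aestronglyMeasurable
    · exact measurable_sigma_fst.sub_const _
    · exact measurable_of_sigma fun m => ((hr m).const_mul lam).neg.add_const lam

end Model

/-! ### Comparing lower integrals with integrals of measurable functions. -/

section LowerIntegral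

variable {μ : Measure Y} {f : Y → ℝ} {c : ℝ}

/-- The sign of `f` bounds the integrals of its minorants; an unbounded real supremum would take the
default value zero. -/
theorem integral_le_lowerIntegral [IsProbabilityMeasure μ] (hf : ∀ y, f y ≤ 0) {g : Y → ℝ}
    (hg : Integrable g μ) (hgf : g ≤ᵐ[μ] f) : ∫ y, g y ∂μ ≤ lowerIntegral μ f := by
  refine le_ciSup (f := fun g : {g : Y → ℝ // Integrable g μ ∧ g ≤ᵐ[μ] f} => ∫ y, g.1 y ∂μ)
    ⟨0, ?_⟩ ⟨g, hg, hgf⟩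
  rintro _ ⟨g, rfl⟩
  exact integral_nonpos_of_ae (g.2.2.trans (Filter.Eventually.of_forall hf))

theorem ofReal_lowerIntegral_add_le [IsProbabilityMeasure μ] (hc : ∀ y, -c ≤ f y)
    {F : Y → ℝ≥0∞} (hF : Measurable F) (hfF : ∀ y, ENNReal.ofReal (f y + c) ≤ F y) :
    ENNReal.ofReal (lowerIntegral μ f + c) ≤ ∫⁻ y, F y ∂μ := by
  by_cases hi : ∫⁻ y, F y ∂μ = ∞
  · simp [hi]
  refine ENNReal.ofReal_le_of_le_toReal ?_
  rw [← le_sub_iff_add_le]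
  -- The constant `-c` is a minorant, so the supremum is not over an empty family.
  have : Nonempty {g : Y → ℝ // Integrable g μ ∧ g ≤ᵐ[μ] f} :=
    ⟨⟨fun _ => -c, integrable_const _, Filter.Eventually.of_forall hc⟩⟩
  refine ciSup_le fun g => ?_
  rw [le_sub_iff_add_le]
  have h1 := integral_add g.2.1 (integrable_const c)
  rw [integral_const, probReal_univ, one_smul] at h1
  rw [← h1, ← integral_toReal hF.aemeasurable (ae_lt_top hF hi)]
  refine integral_mono_ae (g.2.1.add (integrable_const c))
    (integrable_toReal_of_lintegral_ne_top hF.aemeasurable hi) ?_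
  filter_upwards [g.2.2, ae_lt_top hF hi] with y hy hy'
  have h2 := ENNReal.toReal_mono hy'.ne (hfF y)
  rw [ENNReal.toReal_ofReal'] at h2
  have h3 := (le_max_left (f y + c) 0).trans h2
  linarith

theorem integrable_toReal_of_le_const [IsProbabilityMeasure μ] {F : Y → ℝ≥0∞}
    (hF : Measurable F) (hFc : ∀ᵐ y ∂μ, F y ≤ ENNReal.ofReal c) :
    Integrable (fun y => (F y).toReal) μ := by
  refine integrable_toReal_of_lintegral_ne_top hF.aemeasurable ?_
  refine ne_top_of_le_ne_top ?_ (lintegral_mono_ae hFc)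
  simp

/-- The function `F` is almost surely at most `c`, hence `F.toReal - c` is an integrable minorant of
`f`. -/
theorem lintegral_le_ofReal_lowerIntegral_add [IsProbabilityMeasure μ] (hc : ∀ y, -c ≤ f y)
    (hf : ∀ y, f y ≤ 0) {F : Y → ℝ≥0∞} (hF : Measurable F)
    (hFf : ∀ᵐ y ∂μ, F y ≤ ENNReal.ofReal (f y + c)) :
    ∫⁻ y, F y ∂μ ≤ ENNReal.ofReal (lowerIntegral μ f + c) := by
  have hFc : ∀ᵐ y ∂μ, F y ≤ ENNReal.ofReal c := by
    filter_upwards [hFf] with y hy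
    exact hy.trans (ENNReal.ofReal_le_ofReal (by linarith [hf y]))
  have hint := integrable_toReal_of_le_const hF hFc
  have hfin : ∫⁻ y, F y ∂μ ≠ ∞ := ne_top_of_le_ne_top (by simp) (lintegral_mono_ae hFc)
  have h1 := integral_le_lowerIntegral hf (hint.sub (integrable_const c)) (by
    filter_upwards [hFf] with y hy
    have h2 := ENNReal.toReal_mono ENNReal.ofReal_ne_top hy
    rw [ENNReal.toReal_ofReal (by linarith [hc y])] at h2
    simpa using h2)
  have h2 := integral_sub hint (integrable_const (μ := μ) c)
  rw [integral_const, probReal_univ, one_smul,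
    integral_toReal hF.aemeasurable (ae_lt_top hF hfin)] at h2
  rw [← ENNReal.ofReal_toReal hfin]
  refine ENNReal.ofReal_le_ofReal ?_
  simp only [Pi.sub_apply] at h1
  linarith

end LowerIntegral

/-! ### Deterministic decisions. -/

theorem Policy.cont_of_halting {π : Policy A Y} {n : ℕ} {h : Hist A Y n}
    (hπ : π.kern n h = Measure.dirac (Sum.inr ())) :
    π.cont n h = 0 ∧ π.kern n h {Sum.inr ()} = 1 := by
  constructor
  · ext s hs
    rw [Policy.cont, Kernel.comapRight_apply' _ _ _ hs, hπ,
      Measure.dirac_apply' _ hs.inl_image]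
    simp
  · rw [hπ, Measure.dirac_apply_of_mem (mem_singleton _)]

theorem Policy.cont_of_query {π : Policy A Y} {n : ℕ} {h : Hist A Y n} {a : A}
    (hπ : π.kern n h = Measure.dirac (Sum.inl a)) :
    π.cont n h = Measure.dirac a ∧ π.kern n h {Sum.inr ()} = 0 := by
  constructor
  · ext s hs
    rw [Policy.cont, Kernel.comapRight_apply' _ _ _ hs, hπ,
      Measure.dirac_apply' _ hs.inl_image, Measure.dirac_apply' _ hs]
    by_cases ha : a ∈ s <;> simp [ha]
  · have : MeasurableSet ({Sum.inr ()} : Set (A ⊕ Unit)) := by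
      rw [← image_singleton]
      exact (measurableSet_singleton ()).inr_image
    rw [hπ, Measure.dirac_apply' _ this]
    simp

/-- The deterministic policy given by measurable decision rules. -/
noncomputable def Policy.ofRule (d : ∀ n, Hist A Y n → A ⊕ Unit) (hd : ∀ n, Measurable (d n)) :
    Policy A Y where
  kern n := Kernel.deterministic (d n) (hd n)
  markov _ := inferInstance

/-! ### Cost given the history and lower bounds by the value. -/

namespace Model

variable (M : Model Θ A Y X)

instance (n : ℕ) (h : Hist A Y n) : IsProbabilityMeasure (M.givenHist n h) :=
  inferInstanceAs (IsProbabilityMeasure ((M.posterior n h).prod (Measure.dirac h)))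

theorem lintegral_givenHist (n : ℕ) (h : Hist A Y n) {F : Θ × Hist A Y n → ℝ≥0∞}
    (hF : Measurable F) :
    ∫⁻ z, F z ∂(M.givenHist n h) = ∫⁻ θ, F (θ, h) ∂(M.posterior n h) := by
  rw [givenHist, lintegral_prod _ hF.aemeasurable]
  refine lintegral_congr fun θ => ?_
  rw [lintegral_dirac' _ (by fun_prop)]

/-- The query depends on the history but not on the parameter, so Tonelli moves it outside; Bayes'
formula then exchanges parameter and observation. -/
theorem lintegral_next_posterior (π : Policy A Y) (n : ℕ) (h : Hist A Y n)
    (hh : M.Regular n h) {F : ∀ n, Θ × Hist A Y n → ℝ≥0∞} (hF : ∀ n, Measurable (F n)) :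
    ∫⁻ θ, M.next π F n (θ, h) ∂(M.posterior n h)
      = ∫⁻ a, ∫⁻ y, ∫⁻ θ, F (n + 1) (θ, h.append a y) ∂(M.posterior (n + 1) (h.append a y))
          ∂(M.predictive n h a) ∂(π.cont n h) := by
  have hF1 := hF (n + 1)
  simp_rw [next, M.lintegral_step π n _ h hF1]
  rw [lintegral_lintegral_swap (Measurable.aemeasurable
    (M.measurable_lintegral_obs n (g := fun z : Θ × A => (z.1, h, z.2)) (by fun_prop)
      (F := fun z => F (n + 1) (z.1.1, h.append z.1.2 z.2)) (by fun_prop)))]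
  refine lintegral_congr fun a => ?_
  exact M.lintegral_posterior_obs n h hh a
    (F := fun z => F (n + 1) (z.1, h.append a z.2)) (by fun_prop)

theorem lintegral_stageCost_posterior (ε lam : ℝ) (π : Policy A Y) (n : ℕ) (h : Hist A Y n) :
    ∫⁻ θ, M.stageCost ε lam π n (θ, h) ∂(M.posterior n h)
      = π.cont n h univ + π.kern n h {Sum.inr ()} * M.stopCost ε lam n h := by
  simp [stageCost]

/-- The expected shifted cost given the history. -/
noncomputable def histCost (ε lam : ℝ) (π : Policy A Y) (n : ℕ) (h : Hist A Y n) : ℝ≥0∞ :=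
  ∫⁻ θ, M.totalCost ε lam π n (θ, h) ∂(M.posterior n h)

variable {ε lam : ℝ}

theorem measurable_histCost (hr : ∀ n, Measurable (M.bestSuccess (A := A) (Y := Y) ε n))
    (π : Policy A Y) (n : ℕ) : Measurable (M.histCost ε lam π n) :=
  M.measurable_lintegral_posterior n measurable_id
    (F := fun z : Hist A Y n × Θ => M.totalCost ε lam π n (z.2, z.1))
    ((M.measurable_totalCost hr π n).comp measurable_swap)

theorem histCost_eq (hr : ∀ n, Measurable (M.bestSuccess (A := A) (Y := Y) ε n))
    (π : Policy A Y) (n : ℕ) (h : Hist A Y n) (hh : M.Regular n h) :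
    M.histCost ε lam π n h
      = π.cont n h univ + π.kern n h {Sum.inr ()} * M.stopCost ε lam n h
        + ∫⁻ a, ∫⁻ y, M.histCost ε lam π (n + 1) (h.append a y) ∂(M.predictive n h a)
            ∂(π.cont n h) := by
  have h1 := M.measurable_stageCost (lam := lam) hr π n
  rw [histCost, lintegral_congr fun θ => M.totalCost_eq hr π n (θ, h),
    lintegral_add_left (by fun_prop), lintegral_stageCost_posterior,
    M.lintegral_next_posterior π n h hh (M.measurable_totalCost hr π)]
  rfl

/-- The continuing kernel vanishes, so Bayes' formula is not needed and the history may be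
irregular. Hence stopping at once is admissible from every history, and the value is never an
infimum over the empty set. -/
theorem histCost_of_halting (hr : ∀ n, Measurable (M.bestSuccess (A := A) (Y := Y) ε n))
    {π : Policy A Y} {n : ℕ} {h : Hist A Y n}
    (hπ : π.kern n h = Measure.dirac (Sum.inr ())) :
    M.histCost ε lam π n h = M.stopCost ε lam n h := by
  have h1 := M.measurable_stageCost (lam := lam) hr π n
  rw [histCost, lintegral_congr fun θ => M.totalCost_eq hr π n (θ, h),
    lintegral_add_left (by fun_prop), lintegral_stageCost_posterior]
  simp_rw [next, M.lintegral_step π n _ h (M.measurable_totalCost hr π (n + 1)),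
    (Policy.cont_of_halting hπ).1, (Policy.cont_of_halting hπ).2]
  simp

theorem admissible_givenHist_iff (hr : ∀ n, Measurable (M.bestSuccess (A := A) (Y := Y) ε n))
    (hlam : 0 ≤ lam) (π : Policy A Y) (n : ℕ) (h : Hist A Y n) :
    M.Admissible π n (M.givenHist n h) ↔ M.histCost ε lam π n h ≠ ∞ := by
  rw [M.admissible_iff hr hlam, M.lintegral_givenHist n h (M.measurable_totalCost hr π n)]
  rfl

theorem cost_givenHist (hr : ∀ n, Measurable (M.bestSuccess (A := A) (Y := Y) ε n))
    (hlam : 0 ≤ lam) {π : Policy A Y} {n : ℕ} {h : Hist A Y n}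
    (hπ : M.Admissible π n (M.givenHist n h)) :
    M.cost ε lam π n (M.givenHist n h) = (M.histCost ε lam π n h).toReal - lam := by
  rw [M.cost_eq hr hlam π n _ hπ, M.lintegral_givenHist n h (M.measurable_totalCost hr π n)]
  rfl

theorem exists_histCost_eq_stopCost
    (hr : ∀ n, Measurable (M.bestSuccess (A := A) (Y := Y) ε n)) :
    ∃ π : Policy A Y, ∀ n h, M.histCost ε lam π n h = M.stopCost ε lam n h :=
  ⟨Policy.ofRule (fun _ _ => Sum.inr ()) fun _ => measurable_const, fun _ _ =>
    M.histCost_of_halting hr (Kernel.deterministic_apply measurable_const _)⟩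

/-- A policy that is not admissible has infinite shifted cost, so the bound needs no admissibility.
-/
theorem ofReal_value_add_le (hr : ∀ n, Measurable (M.bestSuccess (A := A) (Y := Y) ε n))
    (hlam : 0 ≤ lam) (π : Policy A Y) (n : ℕ) (h : Hist A Y n) :
    ENNReal.ofReal (M.value ε lam n h + lam) ≤ M.histCost ε lam π n h := by
  by_cases hi : M.histCost ε lam π n h = ∞
  · simp [hi]
  have hπ := (M.admissible_givenHist_iff hr hlam π n h).2 hi
  refine ENNReal.ofReal_le_of_le_toReal ?_
  rw [← le_sub_iff_add_le, ← M.cost_givenHist hr hlam hπ]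
  refine ciInf_le (f := fun π : {π : Policy A Y // M.Admissible π n (M.givenHist n h)} =>
    M.cost ε lam π.1 n (M.givenHist n h)) ⟨-lam, ?_⟩ ⟨π, hπ⟩
  rintro _ ⟨π', rfl⟩
  simp only [M.cost_givenHist hr hlam π'.2]
  linarith [ENNReal.toReal_nonneg (a := M.histCost ε lam π'.1 n h)]

theorem toReal_le_value_add (hr : ∀ n, Measurable (M.bestSuccess (A := A) (Y := Y) ε n))
    (hlam : 0 ≤ lam) {n : ℕ} {h : Hist A Y n} {c : ℝ≥0∞}
    (hc : ∀ π, c ≤ M.histCost ε lam π n h) : c.toReal ≤ M.value ε lam n h + lam := by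
  obtain ⟨π, hπ⟩ := M.exists_histCost_eq_stopCost (lam := lam) hr
  have hadm : M.Admissible π n (M.givenHist n h) := by
    rw [M.admissible_givenHist_iff hr hlam, hπ]
    exact ENNReal.ofReal_ne_top
  have : Nonempty {π : Policy A Y // M.Admissible π n (M.givenHist n h)} := ⟨⟨π, hadm⟩⟩
  rw [← sub_le_iff_le_add]
  refine le_ciInf fun π' => ?_
  rw [M.cost_givenHist hr hlam π'.2]
  have := ENNReal.toReal_mono ((M.admissible_givenHist_iff hr hlam π'.1 n h).1 π'.2) (hc π'.1)
  linarith

theorem neg_le_value (hr : ∀ n, Measurable (M.bestSuccess (A := A) (Y := Y) ε n))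
    (hlam : 0 ≤ lam) (n : ℕ) (h : Hist A Y n) : -lam ≤ M.value ε lam n h := by
  have := M.toReal_le_value_add hr hlam (n := n) (h := h) (c := 0) (fun _ => zero_le)
  simp at this
  linarith

theorem value_le_qStop (hr : ∀ n, Measurable (M.bestSuccess (A := A) (Y := Y) ε n))
    (hlam : 0 ≤ lam) (n : ℕ) (h : Hist A Y n) : M.value ε lam n h ≤ M.qStop ε lam n h := by
  obtain ⟨π, hπ⟩ := M.exists_histCost_eq_stopCost (lam := lam) hr
  have h1 := M.ofReal_value_add_le hr hlam π n h
  rw [hπ, stopCost, ENNReal.ofReal_le_ofReal_iff (M.qStop_add_nonneg hlam n h)] at h1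
  linarith

theorem value_nonpos (hr : ∀ n, Measurable (M.bestSuccess (A := A) (Y := Y) ε n))
    (hlam : 0 ≤ lam) (n : ℕ) (h : Hist A Y n) : M.value ε lam n h ≤ 0 :=
  (M.value_le_qStop hr hlam n h).trans (M.qStop_nonpos hlam n h)

/-- A randomized decision is a mixture of stopping and querying, and a mixture is no better than its
best component. After a query, the continuation costs at least `V⋆ + lam` at each next history, and
its cost is measurable in that history, so it dominates the lower integral. -/
theorem min_le_histCost (hr : ∀ n, Measurable (M.bestSuccess (A := A) (Y := Y) ε n))
    (hlam : 0 ≤ lam) {n : ℕ} {h : Hist A Y n} (hh : M.Regular n h) {q : ℝ}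
    (hq : ∀ a, q ≤ M.qCont ε lam n h a) (π : Policy A Y) :
    min (M.stopCost ε lam n h) (ENNReal.ofReal (q + lam)) ≤ M.histCost ε lam π n h := by
  set m := min (M.stopCost ε lam n h) (ENNReal.ofReal (q + lam))
  have h1 : ∀ a, m ≤ 1 + ∫⁻ y, M.histCost ε lam π (n + 1) (h.append a y)
      ∂(M.predictive n h a) := by
    intro a
    have h2 := ofReal_lowerIntegral_add_le (μ := M.predictive n h a)
      (f := fun y => M.value ε lam (n + 1) (h.append a y)) (c := lam)
      (fun y => M.neg_le_value hr hlam _ _)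
      (F := fun y => M.histCost ε lam π (n + 1) (h.append a y))
      ((M.measurable_histCost hr π (n + 1)).comp (by fun_prop))
      (fun y => M.ofReal_value_add_le hr hlam π _ _)
    calc m ≤ ENNReal.ofReal (q + lam) := min_le_right _ _
      _ ≤ ENNReal.ofReal (1 + (lowerIntegral (M.predictive n h a)
            (fun y => M.value ε lam (n + 1) (h.append a y)) + lam)) :=
          ENNReal.ofReal_le_ofReal (by have := hq a; rw [qCont] at this; linarith)
      _ ≤ _ := ENNReal.ofReal_add_le
      _ ≤ _ := by rw [ENNReal.ofReal_one]; gcongr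
  rw [M.histCost_eq hr π n h hh]
  calc m = π.cont n h univ * m + π.kern n h {Sum.inr ()} * m := by
        rw [← add_mul, π.cont_univ_add_stopProb, one_mul]
    _ ≤ (∫⁻ a, (1 + ∫⁻ y, M.histCost ε lam π (n + 1) (h.append a y) ∂(M.predictive n h a))
          ∂(π.cont n h)) + π.kern n h {Sum.inr ()} * M.stopCost ε lam n h := by
        gcongr
        · rw [mul_comm, ← lintegral_const]
          exact lintegral_mono h1
        · exact min_le_left _ _
    _ = _ := by
        rw [lintegral_add_left measurable_const, lintegral_one]
        ring

theorem ae_start_of_posterior {F : ∀ n, Θ × Hist A Y n → ℝ≥0∞} (hF : Measurable (F 0))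
    (h0 : ∀ h, M.Regular 0 h → ∫⁻ θ, F 0 (θ, h) ∂(M.posterior 0 h) = 0) :
    ∫⁻ z, F 0 z ∂M.start = 0 := by
  rw [M.lintegral_start hF, lintegral_eq_zero_of_ae_eq_zero]
  filter_upwards [M.ae_regular_first] with y hy using h0 _ hy

/-- The indicator of irregularity has posterior mean zero at a regular history, and this persists
under `next`, because whatever the query, the next history is almost surely regular. -/
theorem ae_regular_run (π : Policy A Y) (k : ℕ) :
    ∀ᵐ z ∂(M.start.bind (M.run π 0 k)), M.Regular (0 + k) z.2 := by
  have hs : ∀ n, MeasurableSet {z : Θ × Hist A Y n | M.Regular n z.2} := fun n =>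
    (M.measurableSet_regular n).preimage measurable_snd
  let F : ∀ n, Θ × Hist A Y n → ℝ≥0∞ := fun n => {z | M.Regular n z.2}ᶜ.indicator 1
  have hF : ∀ n, Measurable (F n) := fun n => measurable_one.indicator (hs n).compl
  change M.lawAfter π 0 M.start k {z | M.Regular (0 + k) z.2}ᶜ = 0
  rw [← lintegral_indicator_one (hs _).compl]
  change ∫⁻ z, F (0 + k) z ∂_ = 0
  rw [M.lintegral_lawAfter π hF]
  refine M.ae_start_of_posterior (measurable_next_iterate hF k 0) ?_
  have key : ∀ k n h, M.Regular n h →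
      ∫⁻ θ, (M.next π)^[k] F n (θ, h) ∂(M.posterior n h) = 0 := by
    intro k
    induction k with
    | zero =>
      intro n h hh
      simp [F, hh]
    | succ k ih =>
      intro n h hh
      rw [Function.iterate_succ_apply',
        M.lintegral_next_posterior π n h hh (measurable_next_iterate hF k)]
      refine (lintegral_congr fun a => ?_).trans lintegral_zero
      refine lintegral_eq_zero_of_ae_eq_zero ?_
      filter_upwards [M.ae_regular_append n h hh a] with y hy using ih _ _ hy
  exact key k 0

end Model

/-! ### Value iteration along the actor. -/

namespace Model

variable (M : Model Θ A Y X) {ε lam : ℝ} {actor : ∀ n, Hist A Y n → A}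

/-- Optimal shifted cost of stopping within `k` queries chosen by the actor, where continuing
after the last of them is free. -/
noncomputable def iterValue (ε lam : ℝ) (actor : ∀ n, Hist A Y n → A) :
    ℕ → ∀ n, Hist A Y n → ℝ≥0∞
  | 0 => fun _ _ => 0
  | k + 1 => fun n h => min (M.stopCost ε lam n h)
      (1 + ∫⁻ y, iterValue ε lam actor k (n + 1) (h.append (actor n h) y)
        ∂(M.predictive n h (actor n h)))

/-- The increasing limit of the value iteration along the actor. -/
noncomputable def limitValue (ε lam : ℝ) (actor : ∀ n, Hist A Y n → A) (n : ℕ)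
    (h : Hist A Y n) : ℝ≥0∞ :=
  ⨆ k, M.iterValue ε lam actor k n h

theorem measurable_iterValue (hr : ∀ n, Measurable (M.bestSuccess (A := A) (Y := Y) ε n))
    (hact : ∀ n, Measurable (actor n)) (k n : ℕ) :
    Measurable (M.iterValue ε lam actor k n) := by
  induction k generalizing n with
  | zero => exact measurable_const
  | succ k ih =>
    have h1 := hact n
    have h2 := ih (n + 1)
    exact (M.measurable_stopCost hr n).min (measurable_const.add
      (M.measurable_lintegral_predictive n measurable_id h1
        (F := fun z => M.iterValue ε lam actor k (n + 1) (z.1.append (actor n z.1) z.2))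
        (by fun_prop)))

theorem measurable_limitValue (hr : ∀ n, Measurable (M.bestSuccess (A := A) (Y := Y) ε n))
    (hact : ∀ n, Measurable (actor n)) (n : ℕ) : Measurable (M.limitValue ε lam actor n) :=
  Measurable.iSup fun k => M.measurable_iterValue hr hact k n

theorem iterValue_mono (n : ℕ) (h : Hist A Y n) :
    Monotone fun k => M.iterValue ε lam actor k n h := by
  refine monotone_nat_of_le_succ fun k => ?_
  induction k generalizing n with
  | zero => exact zero_le
  | succ k ih =>
    refine min_le_min_left _ ?_
    gcongr with y
    exact ih _ _

theorem limitValue_eq (hr : ∀ n, Measurable (M.bestSuccess (A := A) (Y := Y) ε n))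
    (hact : ∀ n, Measurable (actor n)) (n : ℕ) (h : Hist A Y n) :
    M.limitValue ε lam actor n h = min (M.stopCost ε lam n h)
      (1 + ∫⁻ y, M.limitValue ε lam actor (n + 1) (h.append (actor n h) y)
        ∂(M.predictive n h (actor n h))) := by
  -- Dropping the initial iterate does not change the supremum of an increasing sequence and exposes
  -- the recursion; monotone convergence then applies.
  rw [limitValue, ← (M.iterValue_mono n h).iSup_nat_add 1]
  simp only [limitValue, iterValue]
  have hm : ∀ k, Measurable fun y =>
      M.iterValue ε lam actor k (n + 1) (h.append (actor n h) y) := fun k =>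
    (M.measurable_iterValue hr hact k (n + 1)).comp (by fun_prop)
  rw [lintegral_iSup hm (fun i j hij y => M.iterValue_mono (n + 1) _ hij), ENNReal.add_iSup]
  exact (inf_iSup_eq _ _).symm

/-- The induction hypothesis holds at almost every next history, so the iterate integrates to at
most the lower integral of the shifted value. Minimality of the actor turns the resulting bound at a
single query into one for all queries, hence for all policies. This is where the minimizing property
enters. -/
theorem iterValue_le_value (hr : ∀ n, Measurable (M.bestSuccess (A := A) (Y := Y) ε n))
    (hlam : 0 ≤ lam) (hact : ∀ n, Measurable (actor n))
    (hmin : ∀ n h, M.Regular n h → IsMinOn (M.qCont ε lam n h) univ (actor n h))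
    (k n : ℕ) (h : Hist A Y n) (hh : M.Regular n h) :
    M.iterValue ε lam actor k n h ≤ ENNReal.ofReal (M.value ε lam n h + lam) := by
  induction k generalizing n with
  | zero => exact zero_le
  | succ k ih =>
    have h1 := lintegral_le_ofReal_lowerIntegral_add (μ := M.predictive n h (actor n h))
      (f := fun y => M.value ε lam (n + 1) (h.append (actor n h) y)) (c := lam)
      (fun y => M.neg_le_value hr hlam _ _) (fun y => M.value_nonpos hr hlam _ _)
      (F := fun y => M.iterValue ε lam actor k (n + 1) (h.append (actor n h) y))
      ((M.measurable_iterValue hr hact k (n + 1)).comp (by fun_prop))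
      ((M.ae_regular_append n h hh _).mono fun y hy => ih _ _ hy)
    -- The lower integral is at least `-lam`, so `ENNReal.ofReal` is additive on the two summands
    -- below.
    have h0 := integral_le_lowerIntegral (μ := M.predictive n h (actor n h))
      (f := fun y => M.value ε lam (n + 1) (h.append (actor n h) y))
      (fun y => M.value_nonpos hr hlam _ _) (integrable_const (-lam))
      (Filter.Eventually.of_forall fun y => M.neg_le_value hr hlam _ _)
    rw [integral_const, probReal_univ, one_smul] at h0
    have h2 : M.iterValue ε lam actor (k + 1) n h ≤ min (M.stopCost ε lam n h)
        (ENNReal.ofReal (M.qCont ε lam n h (actor n h) + lam)) := by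
      refine min_le_min_left _ ?_
      rw [qCont, add_assoc, ENNReal.ofReal_add zero_le_one (by linarith), ENNReal.ofReal_one]
      gcongr
    have h3 := M.toReal_le_value_add hr hlam
      (M.min_le_histCost hr hlam hh fun a => hmin n h hh (mem_univ a))
    refine h2.trans ?_
    rwa [ENNReal.le_ofReal_iff_toReal_le
      (ne_top_of_le_ne_top ENNReal.ofReal_ne_top (min_le_right _ _))
      (by linarith [M.neg_le_value (ε := ε) hr hlam n h])]

/-- `π` stops exactly when stopping is optimal for `limitValue`, and otherwise queries the
actor. -/
def FollowsLimit (ε lam : ℝ) (actor : ∀ n, Hist A Y n → A) (π : Policy A Y) : Prop :=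
  ∀ n h, M.Regular n h →
    (M.limitValue ε lam actor n h = M.stopCost ε lam n h ∧
      π.kern n h = Measure.dirac (Sum.inr ())) ∨
    (M.limitValue ε lam actor n h
        = 1 + ∫⁻ y, M.limitValue ε lam actor (n + 1) (h.append (actor n h) y)
          ∂(M.predictive n h (actor n h)) ∧
      π.kern n h = Measure.dirac (Sum.inl (actor n h)))

/-- Truncation makes this an induction: the cost left after `N` decisions is discarded, which is
harmless because it is nonnegative. No control of the value at infinity is required. -/
theorem lintegral_costUpTo_le (hr : ∀ n, Measurable (M.bestSuccess (A := A) (Y := Y) ε n))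
    {π : Policy A Y} (hπ : M.FollowsLimit ε lam actor π) (N n : ℕ) (h : Hist A Y n)
    (hh : M.Regular n h) :
    ∫⁻ θ, M.costUpTo ε lam π N n (θ, h) ∂(M.posterior n h) ≤ M.limitValue ε lam actor n h := by
  induction N generalizing n with
  | zero => simp [costUpTo]
  | succ N ih =>
    have h1 := M.measurable_stageCost (lam := lam) hr π n
    rw [lintegral_congr fun θ => M.costUpTo_succ hr π N n (θ, h),
      lintegral_add_left (by fun_prop), lintegral_stageCost_posterior,
      M.lintegral_next_posterior π n h hh (M.measurable_costUpTo hr π N)]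
    rcases hπ n h hh with ⟨hU, hk⟩ | ⟨hU, hk⟩
    · rw [(Policy.cont_of_halting hk).1, (Policy.cont_of_halting hk).2, hU]
      simp
    · have h2 : Measurable fun a => ∫⁻ y, ∫⁻ θ,
          M.costUpTo ε lam π N (n + 1) (θ, h.append a y)
            ∂(M.posterior (n + 1) (h.append a y)) ∂(M.predictive n h a) := by
        have h3 := M.measurable_costUpTo (lam := lam) hr π N (n + 1)
        exact M.measurable_lintegral_predictive n (g := fun _ => h) (a := fun a => a)
          measurable_const measurable_id
          (F := fun z => ∫⁻ θ, M.costUpTo ε lam π N (n + 1) (θ, h.append z.1 z.2)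
            ∂(M.posterior (n + 1) (h.append z.1 z.2)))
          (M.measurable_lintegral_posterior (n + 1)
            (g := fun z : A × Y => h.append z.1 z.2) (by fun_prop)
            (F := fun z => M.costUpTo ε lam π N (n + 1) (z.2, h.append z.1.1 z.1.2))
            (by fun_prop))
      rw [(Policy.cont_of_query hk).1, (Policy.cont_of_query hk).2, lintegral_dirac' _ h2, hU,
        measure_univ, zero_mul, add_zero]
      refine add_le_add_right (lintegral_mono_ae ?_) 1
      filter_upwards [M.ae_regular_append n h hh (actor n h)] with y hy using ih _ _ hy

theorem histCost_le_limitValue (hr : ∀ n, Measurable (M.bestSuccess (A := A) (Y := Y) ε n))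
    {π : Policy A Y} (hπ : M.FollowsLimit ε lam actor π) (n : ℕ) (h : Hist A Y n)
    (hh : M.Regular n h) : M.histCost ε lam π n h ≤ M.limitValue ε lam actor n h := by
  rw [histCost]
  simp_rw [totalCost_eq_iSup]
  have hm : ∀ N, Measurable fun θ => M.costUpTo ε lam π N n (θ, h) := fun N =>
    (M.measurable_costUpTo hr π N n).comp (by fun_prop)
  rw [lintegral_iSup hm]
  · exact iSup_le fun N => M.lintegral_costUpTo_le hr hπ N n h hh
  · intro i j hij θ
    exact Finset.sum_le_sum_of_subset (Finset.range_mono hij)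

open Classical in
-- The threshold is written with `limitValue`, measurable on all histories, because a rule in terms
-- of the value could fail to be measurable at irregular ones.
theorem exists_threshold_policy (hr : ∀ n, Measurable (M.bestSuccess (A := A) (Y := Y) ε n))
    (hact : ∀ n, Measurable (actor n)) :
    ∃ π : Policy A Y, ∀ n h, π.kern n h =
      if M.stopCost ε lam n h ≤ 1 + ∫⁻ y, M.limitValue ε lam actor (n + 1)
          (h.append (actor n h) y) ∂(M.predictive n h (actor n h))
        then Measure.dirac (Sum.inr ()) else Measure.dirac (Sum.inl (actor n h)) := by
  have hm : ∀ n, Measurable fun h : Hist A Y n =>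
      1 + ∫⁻ y, M.limitValue ε lam actor (n + 1) (h.append (actor n h) y)
        ∂(M.predictive n h (actor n h)) := by
    intro n
    have h1 := hact n
    have h2 := M.measurable_limitValue (lam := lam) hr hact (n + 1)
    exact measurable_const.add (M.measurable_lintegral_predictive n measurable_id h1
      (F := fun z => M.limitValue ε lam actor (n + 1) (z.1.append (actor n z.1) z.2))
      (by fun_prop))
  refine ⟨Policy.ofRule (fun n h => if M.stopCost ε lam n h ≤ 1 + ∫⁻ y,
    M.limitValue ε lam actor (n + 1) (h.append (actor n h) y) ∂(M.predictive n h (actor n h))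
    then Sum.inr () else Sum.inl (actor n h)) fun n => ?_, fun n h => ?_⟩
  · exact Measurable.ite (measurableSet_le (M.measurable_stopCost hr n) (hm n))
      measurable_const (measurable_inl.comp (hact n))
  · simp only [Policy.ofRule, Kernel.deterministic_apply]
    split_ifs <;> rfl

theorem followsLimit_of_kern (hr : ∀ n, Measurable (M.bestSuccess (A := A) (Y := Y) ε n))
    (hact : ∀ n, Measurable (actor n)) {π : Policy A Y} {P : ∀ n, Hist A Y n → Prop}
    [∀ n h, Decidable (P n h)]
    (hP : ∀ n h, M.Regular n h → (P n h ↔ M.stopCost ε lam n h ≤ 1 + ∫⁻ y,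
      M.limitValue ε lam actor (n + 1) (h.append (actor n h) y)
        ∂(M.predictive n h (actor n h))))
    (hπ : ∀ n h, M.Regular n h → π.kern n h = if P n h
      then Measure.dirac (Sum.inr ()) else Measure.dirac (Sum.inl (actor n h))) :
    M.FollowsLimit ε lam actor π := by
  intro n h hh
  rw [hπ n h hh, M.limitValue_eq hr hact n h]
  by_cases hp : P n h
  · exact Or.inl ⟨min_eq_left ((hP n h hh).1 hp), if_pos hp⟩
  · exact Or.inr ⟨min_eq_right (le_of_not_ge fun hle => hp ((hP n h hh).2 hle)), if_neg hp⟩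

/-- The threshold policy attains at most the limit, and every iterate is below the shifted value. -/
theorem ofReal_value_eq (hr : ∀ n, Measurable (M.bestSuccess (A := A) (Y := Y) ε n))
    (hlam : 0 ≤ lam) (hact : ∀ n, Measurable (actor n))
    (hmin : ∀ n h, M.Regular n h → IsMinOn (M.qCont ε lam n h) univ (actor n h))
    {n : ℕ} {h : Hist A Y n} (hh : M.Regular n h) :
    ENNReal.ofReal (M.value ε lam n h + lam) = M.limitValue ε lam actor n h := by
  classical
  obtain ⟨π, hπ⟩ := M.exists_threshold_policy (lam := lam) hr hact
  have hπ' : M.FollowsLimit ε lam actor π :=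
    M.followsLimit_of_kern hr hact (fun _ _ _ => Iff.rfl) fun n h _ => hπ n h
  exact le_antisymm
    ((M.ofReal_value_add_le hr hlam π n h).trans (M.histCost_le_limitValue hr hπ' n h hh))
    (iSup_le fun k => M.iterValue_le_value hr hlam hact hmin k n h hh)

theorem histCost_eq_limitValue (hr : ∀ n, Measurable (M.bestSuccess (A := A) (Y := Y) ε n))
    (hlam : 0 ≤ lam) (hact : ∀ n, Measurable (actor n))
    (hmin : ∀ n h, M.Regular n h → IsMinOn (M.qCont ε lam n h) univ (actor n h))
    {π : Policy A Y} (hπ : M.FollowsLimit ε lam actor π) {n : ℕ} {h : Hist A Y n}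
    (hh : M.Regular n h) : M.histCost ε lam π n h = M.limitValue ε lam actor n h :=
  le_antisymm (M.histCost_le_limitValue hr hπ n h hh)
    (by rw [← M.ofReal_value_eq hr hlam hact hmin hh]; exact M.ofReal_value_add_le hr hlam π n h)

theorem limitValue_le (hr : ∀ n, Measurable (M.bestSuccess (A := A) (Y := Y) ε n))
    (hlam : 0 ≤ lam) (hact : ∀ n, Measurable (actor n)) (n : ℕ) (h : Hist A Y n) :
    M.limitValue ε lam actor n h ≤ ENNReal.ofReal lam := by
  rw [M.limitValue_eq hr hact]
  exact (min_le_left _ _).trans (M.stopCost_le hlam n h)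

theorem value_ae_eq (hr : ∀ n, Measurable (M.bestSuccess (A := A) (Y := Y) ε n))
    (hlam : 0 ≤ lam) (hact : ∀ n, Measurable (actor n))
    (hmin : ∀ n h, M.Regular n h → IsMinOn (M.qCont ε lam n h) univ (actor n h))
    {n : ℕ} {h : Hist A Y n} (hh : M.Regular n h) (a : A) :
    (fun y => (M.limitValue ε lam actor (n + 1) (h.append a y)).toReal - lam)
      =ᵐ[M.predictive n h a] fun y => M.value ε lam (n + 1) (h.append a y) := by
  filter_upwards [M.ae_regular_append n h hh a] with y hy
  rw [← M.ofReal_value_eq hr hlam hact hmin hy,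
    ENNReal.toReal_ofReal (by linarith [M.neg_le_value (ε := ε) hr hlam _ (h.append a y)])]
  ring

theorem integrable_limitValue (hr : ∀ n, Measurable (M.bestSuccess (A := A) (Y := Y) ε n))
    (hlam : 0 ≤ lam) (hact : ∀ n, Measurable (actor n)) (n : ℕ) (h : Hist A Y n) (a : A) :
    Integrable (fun y => (M.limitValue ε lam actor (n + 1) (h.append a y)).toReal)
      (M.predictive n h a) :=
  integrable_toReal_of_le_const
    ((M.measurable_limitValue hr hact (n + 1)).comp (by fun_prop))
    (Filter.Eventually.of_forall fun _ => M.limitValue_le hr hlam hact _ _)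

/-- The value agrees with the bounded measurable `limitValue - lam` wherever the next history is
regular, that is, almost surely. -/
theorem integrable_value (hr : ∀ n, Measurable (M.bestSuccess (A := A) (Y := Y) ε n))
    (hlam : 0 ≤ lam) (hact : ∀ n, Measurable (actor n))
    (hmin : ∀ n h, M.Regular n h → IsMinOn (M.qCont ε lam n h) univ (actor n h))
    {n : ℕ} {h : Hist A Y n} (hh : M.Regular n h) (a : A) :
    Integrable (fun y => M.value ε lam (n + 1) (h.append a y)) (M.predictive n h a) :=
  ((M.integrable_limitValue hr hlam hact n h a).sub (integrable_const lam)).congr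
    (M.value_ae_eq hr hlam hact hmin hh a)

theorem ofReal_qCont_add (hr : ∀ n, Measurable (M.bestSuccess (A := A) (Y := Y) ε n))
    (hlam : 0 ≤ lam) (hact : ∀ n, Measurable (actor n))
    (hmin : ∀ n h, M.Regular n h → IsMinOn (M.qCont ε lam n h) univ (actor n h))
    {n : ℕ} {h : Hist A Y n} (hh : M.Regular n h) (a : A) :
    0 ≤ M.qCont ε lam n h a + lam ∧
    ENNReal.ofReal (M.qCont ε lam n h a + lam)
      = 1 + ∫⁻ y, M.limitValue ε lam actor (n + 1) (h.append a y) ∂(M.predictive n h a) := by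
  have hm : Measurable fun y => M.limitValue ε lam actor (n + 1) (h.append a y) :=
    (M.measurable_limitValue hr hact (n + 1)).comp (by fun_prop)
  have hle : ∀ y, M.limitValue ε lam actor (n + 1) (h.append a y) ≤ ENNReal.ofReal lam :=
    fun y => M.limitValue_le hr hlam hact _ _
  have hfin : ∫⁻ y, M.limitValue ε lam actor (n + 1) (h.append a y) ∂(M.predictive n h a) ≠ ∞ :=
    ne_top_of_le_ne_top (by simp) (lintegral_mono hle)
  have h1 : M.qCont ε lam n h a + lam = 1 + (∫⁻ y, M.limitValue ε lam actor (n + 1)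
      (h.append a y) ∂(M.predictive n h a)).toReal := by
    rw [qCont, lowerIntegral_eq_integral _ _ (M.integrable_value hr hlam hact hmin hh a),
      ← integral_congr_ae (M.value_ae_eq hr hlam hact hmin hh a),
      integral_sub (M.integrable_limitValue hr hlam hact n h a) (integrable_const _),
      integral_const, probReal_univ, one_smul,
      integral_toReal hm.aemeasurable
        (Filter.Eventually.of_forall fun y => (hle y).trans_lt ENNReal.ofReal_lt_top)]
    ring
  rw [h1]
  refine ⟨by positivity, ?_⟩
  rw [ENNReal.ofReal_add zero_le_one ENNReal.toReal_nonneg, ENNReal.ofReal_one,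
    ENNReal.ofReal_toReal hfin]

theorem qStop_le_qCont_iff (hr : ∀ n, Measurable (M.bestSuccess (A := A) (Y := Y) ε n))
    (hlam : 0 ≤ lam) (hact : ∀ n, Measurable (actor n))
    (hmin : ∀ n h, M.Regular n h → IsMinOn (M.qCont ε lam n h) univ (actor n h))
    (n : ℕ) (h : Hist A Y n) (hh : M.Regular n h) :
    M.qStop ε lam n h ≤ M.qCont ε lam n h (actor n h) ↔
      M.stopCost ε lam n h ≤ 1 + ∫⁻ y, M.limitValue ε lam actor (n + 1)
        (h.append (actor n h) y) ∂(M.predictive n h (actor n h)) := by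
  obtain ⟨h1, h2⟩ := M.ofReal_qCont_add hr hlam hact hmin hh (actor n h)
  rw [← h2, stopCost, ENNReal.ofReal_le_ofReal_iff h1, add_le_add_iff_right]

theorem bellman (hr : ∀ n, Measurable (M.bestSuccess (A := A) (Y := Y) ε n))
    (hlam : 0 ≤ lam) (hact : ∀ n, Measurable (actor n))
    (hmin : ∀ n h, M.Regular n h → IsMinOn (M.qCont ε lam n h) univ (actor n h))
    (n : ℕ) (h : Hist A Y n) (hh : M.Regular n h) :
    M.value ε lam n h = min (M.qStop ε lam n h) (⨅ a, M.qCont ε lam n h a) := by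
  have h0 : ⨅ a, M.qCont ε lam n h a = M.qCont ε lam n h (actor n h) :=
    IsLeast.csInf_eq ⟨mem_range_self _, by
      rintro _ ⟨a, rfl⟩
      exact hmin n h hh (mem_univ a)⟩
  obtain ⟨h1, h2⟩ := M.ofReal_qCont_add hr hlam hact hmin hh (actor n h)
  have h3 := M.ofReal_value_eq hr hlam hact hmin hh
  rw [M.limitValue_eq hr hact, ← h2, stopCost, ← ENNReal.ofReal_min,
    ENNReal.ofReal_eq_ofReal_iff (by linarith [M.neg_le_value (ε := ε) hr hlam n h])
      (le_min (M.qStop_add_nonneg hlam n h) h1), min_add_add_right] at h3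
  rw [h0]
  linarith

theorem followsLimit_of_followsActor
    (hr : ∀ n, Measurable (M.bestSuccess (A := A) (Y := Y) ε n))
    (hlam : 0 ≤ lam) (hact : ∀ n, Measurable (actor n))
    (hmin : ∀ n h, M.Regular n h → IsMinOn (M.qCont ε lam n h) univ (actor n h))
    {π : Policy A Y} (hπ : M.FollowsActor ε lam actor π) : M.FollowsLimit ε lam actor π := by
  classical
  exact M.followsLimit_of_kern hr hact (M.qStop_le_qCont_iff hr hlam hact hmin) (by convert! hπ)

theorem exists_followsActor (hr : ∀ n, Measurable (M.bestSuccess (A := A) (Y := Y) ε n))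
    (hlam : 0 ≤ lam) (hact : ∀ n, Measurable (actor n))
    (hmin : ∀ n h, M.Regular n h → IsMinOn (M.qCont ε lam n h) univ (actor n h)) :
    ∃ π : Policy A Y, M.FollowsActor ε lam actor π := by
  obtain ⟨π, hπ⟩ := M.exists_threshold_policy (lam := lam) hr hact
  refine ⟨π, fun n h hh => ?_⟩
  rw [hπ]
  simp only [M.qStop_le_qCont_iff hr hlam hact hmin n h hh]

theorem optimal_givenHist (hr : ∀ n, Measurable (M.bestSuccess (A := A) (Y := Y) ε n))
    (hlam : 0 ≤ lam) (hact : ∀ n, Measurable (actor n))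
    (hmin : ∀ n h, M.Regular n h → IsMinOn (M.qCont ε lam n h) univ (actor n h))
    {π : Policy A Y} (hπ : M.FollowsActor ε lam actor π) (n : ℕ) (h : Hist A Y n)
    (hh : M.Regular n h) :
    M.Admissible π n (M.givenHist n h) ∧
      M.cost ε lam π n (M.givenHist n h) = M.value ε lam n h := by
  have h1 := M.histCost_eq_limitValue hr hlam hact hmin
    (M.followsLimit_of_followsActor hr hlam hact hmin hπ) hh
  rw [← M.ofReal_value_eq hr hlam hact hmin hh] at h1
  have hadm : M.Admissible π n (M.givenHist n h) := by
    rw [M.admissible_givenHist_iff hr hlam, h1]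
    exact ENNReal.ofReal_ne_top
  refine ⟨hadm, ?_⟩
  rw [M.cost_givenHist hr hlam hadm, h1,
    ENNReal.toReal_ofReal (by linarith [M.neg_le_value (ε := ε) hr hlam n h])]
  ring

instance : IsProbabilityMeasure M.firstLaw :=
  ⟨by rw [← lintegral_one, M.lintegral_firstLaw measurable_const]; simp⟩

instance : IsProbabilityMeasure (M.start (A := A)) :=
  ⟨by rw [← lintegral_one, M.lintegral_start measurable_const]; simp⟩

theorem lintegral_totalCost_start (hr : ∀ n, Measurable (M.bestSuccess (A := A) (Y := Y) ε n))
    (π : Policy A Y) :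
    ∫⁻ z, M.totalCost ε lam π 0 z ∂M.start
      = ∫⁻ y, M.histCost ε lam π 0 (Hist.first A y) ∂M.firstLaw :=
  M.lintegral_start (M.measurable_totalCost hr π 0)

/-- Conditioning on the first observation reduces the claim to an almost sure comparison of
`histCost`, so the competitor need not be admissible from individual histories. -/
theorem optimal_start (hr : ∀ n, Measurable (M.bestSuccess (A := A) (Y := Y) ε n))
    (hlam : 0 ≤ lam) (hact : ∀ n, Measurable (actor n))
    (hmin : ∀ n h, M.Regular n h → IsMinOn (M.qCont ε lam n h) univ (actor n h))
    {π : Policy A Y} (hπ : M.FollowsActor ε lam actor π) :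
    M.Admissible π 0 M.start ∧
      ∀ π' : Policy A Y, M.Admissible π' 0 M.start →
        M.cost ε lam π 0 M.start ≤ M.cost ε lam π' 0 M.start := by
  have h1 : ∀ᵐ y ∂M.firstLaw, M.histCost ε lam π 0 (Hist.first A y)
      = ENNReal.ofReal (M.value ε lam 0 (Hist.first A y) + lam) := by
    filter_upwards [M.ae_regular_first] with y hy
    rw [M.ofReal_value_eq hr hlam hact hmin hy]
    exact M.histCost_eq_limitValue hr hlam hact hmin
      (M.followsLimit_of_followsActor hr hlam hact hmin hπ) hy
  have hadm : M.Admissible π 0 M.start := by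
    rw [M.admissible_iff hr hlam, M.lintegral_totalCost_start hr]
    refine ne_top_of_le_ne_top (b := ENNReal.ofReal lam) ENNReal.ofReal_ne_top ?_
    calc _ ≤ ∫⁻ _, ENNReal.ofReal lam ∂M.firstLaw := by
          refine lintegral_mono_ae ?_
          filter_upwards [h1] with y hy
          rw [hy]
          exact ENNReal.ofReal_le_ofReal (by
            linarith [M.value_nonpos (ε := ε) hr hlam 0 (Hist.first A y)])
      _ = _ := by simp
  refine ⟨hadm, fun π' hπ' => ?_⟩
  rw [M.cost_eq hr hlam π 0 _ hadm, M.cost_eq hr hlam π' 0 _ hπ']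
  refine sub_le_sub_right (ENNReal.toReal_mono ((M.admissible_iff hr hlam π' 0 _).1 hπ') ?_) _
  rw [M.lintegral_totalCost_start hr, M.lintegral_totalCost_start hr]
  refine lintegral_mono_ae ?_
  filter_upwards [h1] with y hy
  rw [hy]
  exact M.ofReal_value_add_le hr hlam π' 0 _

end Model

/-! ### Measurability of the best success probability. -/

section Success

open Filter

variable [TopologicalSpace X] [CompactSpace X] [TopologicalSpace.MetrizableSpace X]

/-- The right side involves only countably many decisions. For `≤`, a dense point near `x` has loss
below the relaxed threshold whenever `L θ x ≤ ε`, and Fatou's lemma applies. For `≥`, near-optimal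
points with tolerances tending to zero accumulate at some `x` by compactness, and the reverse Fatou
lemma applies. -/
theorem iSup_measure_sublevel_eq [Nonempty X] {L : Θ → X → ℝ} (hL : ∀ x, Measurable fun θ => L θ x)
    (hcont : ∀ θ, Continuous (L θ)) (ε : ℝ) (μ : Measure Θ) [IsProbabilityMeasure μ] :
    ⨆ x, μ {θ | L θ x ≤ ε}
      = ⨅ k : ℕ, ⨆ i, μ {θ | L θ (TopologicalSpace.denseSeq X i) < ε + 1 / ((k : ℝ) + 1)} := by
  have hm : ∀ x c, MeasurableSet {θ | L θ x < c} := fun x c => measurableSet_lt (hL x)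
    measurable_const
  have hm' : ∀ x, MeasurableSet {θ | L θ x ≤ ε} := fun x => measurableSet_le (hL x)
    measurable_const
  refine le_antisymm (iSup_le fun x => le_iInf fun k => ?_) (le_of_forall_lt_imp_le_of_dense fun c hc => ?_)
  · have hδ : ε < ε + 1 / ((k : ℝ) + 1) := lt_add_of_pos_right _ (by positivity)
    set c := ε + 1 / ((k : ℝ) + 1)
    -- The filter of indices whose dense point is close to `x`; it is nontrivial by density.
    let u := comap (TopologicalSpace.denseSeq X) (nhds x)
    have hu : u.NeBot := by
      have := (TopologicalSpace.denseRange_denseSeq X) x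
      rw [mem_closure_iff_nhds] at this
      rw [comap_neBot_iff]
      intro t ht
      obtain ⟨_, hy, i, rfl⟩ := this t ht
      exact ⟨i, hy⟩
    calc μ {θ | L θ x ≤ ε} = ∫⁻ θ, {θ | L θ x ≤ ε}.indicator 1 θ ∂μ :=
          (lintegral_indicator_one (hm' x)).symm
      _ ≤ ∫⁻ θ, liminf (fun i => {θ | L θ (TopologicalSpace.denseSeq X i) < c}.indicator
            (1 : Θ → ℝ≥0∞) θ) u ∂μ := by
          refine lintegral_mono fun θ => ?_
          by_cases hθ : L θ x ≤ ε
          · refine le_liminf_of_le (by isBoundedDefault) ?_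
            have h1 : ∀ᶠ x' in nhds x, L θ x' < c :=
              (hcont θ).continuousAt.eventually_lt continuousAt_const (hθ.trans_lt hδ)
            filter_upwards [h1.comap (TopologicalSpace.denseSeq X)] with i hi
            simp [indicator, hi, hθ]
          · simp [indicator, hθ]
      _ ≤ liminf (fun i => ∫⁻ θ, {θ | L θ (TopologicalSpace.denseSeq X i) < c}.indicator
            (1 : Θ → ℝ≥0∞) θ ∂μ) u :=
          lintegral_liminf_le fun i => measurable_one.indicator (hm _ _)
      _ ≤ _ := by
          simp_rw [lintegral_indicator_one (hm _ _)]
          exact (liminf_le_limsup (by isBoundedDefault) (by isBoundedDefault)).trans limsup_le_iSup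
  · have hk : ∀ k : ℕ, ∃ x, c < μ {θ | L θ x < ε + 1 / ((k : ℝ) + 1)} := by
      intro k
      obtain ⟨i, hi⟩ := lt_iSup_iff.1 (hc.trans_le (iInf_le _ k))
      exact ⟨_, hi⟩
    choose w hw using hk
    obtain ⟨x, φ, hφ, hx⟩ := CompactSpace.tendsto_subseq w
    refine le_trans ?_ (le_iSup _ x)
    let F : ℕ → Θ → ℝ≥0∞ := fun j =>
      {θ | L θ (w (φ j)) < ε + 1 / ((φ j : ℝ) + 1)}.indicator 1
    calc c ≤ limsup (fun j => ∫⁻ θ, F j θ ∂μ) atTop := by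
          refine le_limsup_of_frequently_le (Frequently.of_forall fun j => ?_)
            (by isBoundedDefault)
          simp only [F]
          rw [lintegral_indicator_one (hm _ _)]
          exact (hw (φ j)).le
      _ ≤ ∫⁻ θ, limsup (fun j => F j θ) atTop ∂μ := by
          refine limsup_lintegral_le 1 (fun j => measurable_one.indicator (hm _ _))
            (fun j => Eventually.of_forall fun θ => ?_) (by simp)
          exact indicator_le_self' (fun _ _ => zero_le) _
      _ ≤ ∫⁻ θ, {θ | L θ x ≤ ε}.indicator 1 θ ∂μ := by
          refine lintegral_mono fun θ => ?_
          by_cases hθ : L θ x ≤ ε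
          · refine limsup_le_of_le (by isBoundedDefault) (Eventually.of_forall fun j => ?_)
            rw [indicator_of_mem (s := {θ | L θ x ≤ ε}) hθ]
            exact indicator_le_self' (fun _ _ => zero_le) _
          · have h1 : Tendsto (fun j => L θ (w (φ j))) atTop (nhds (L θ x)) :=
              ((hcont θ).tendsto x).comp hx
            have h2 : Tendsto (fun j => ε + 1 / ((φ j : ℝ) + 1)) atTop (nhds (ε + 0)) :=
              (tendsto_one_div_add_atTop_nhds_zero_nat.comp hφ.tendsto_atTop).const_add ε
            rw [add_zero] at h2
            refine limsup_le_of_le (by isBoundedDefault) ?_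
            filter_upwards [h2.eventually_lt h1 (not_le.1 hθ)] with j hj
            rw [indicator_of_notMem (s := {θ | L θ x ≤ ε}) hθ]
            exact (indicator_of_notMem
              (s := {θ | L θ (w (φ j)) < ε + 1 / ((φ j : ℝ) + 1)}) (not_lt.2 hj.le) _).le
      _ = μ {θ | L θ x ≤ ε} := lintegral_indicator_one (hm' x)

theorem Model.measurable_bestSuccess [Nonempty X] (M : Model Θ A Y X)
    (hloss : ∀ θ, Continuous (M.loss θ)) (ε : ℝ) (n : ℕ) :
    Measurable (M.bestSuccess (A := A) (Y := Y) ε n) := by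
  have h1 : M.bestSuccess (A := A) (Y := Y) ε n = fun h =>
      (⨅ k : ℕ, ⨆ i, M.posterior n h
        {θ | M.loss θ (TopologicalSpace.denseSeq X i) < ε + 1 / ((k : ℝ) + 1)}).toReal := by
    funext h
    rw [← iSup_measure_sublevel_eq M.measurable_loss hloss, ENNReal.toReal_iSup
      fun _ => measure_ne_top _ _]
    rfl
  rw [h1]
  refine Measurable.ennreal_toReal (Measurable.iInf fun k => Measurable.iSup fun i => ?_)
  exact (M.posteriorKernel n).measurable_coe (measurableSet_lt (M.measurable_loss _)
    measurable_const)

end Success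

/-! ### Lipschitz approximation of lower semicontinuous functions. -/

section InfConvolution

open Filter

variable {Z : Type*} [PseudoMetricSpace Z] {f : Z → ℝ} {c : ℝ}

/-- The largest `m`-Lipschitz function below `f`. -/
noncomputable def infConv (f : Z → ℝ) (m : ℕ) (z : Z) : ℝ := ⨅ w, (f w + m * dist z w)

theorem bddBelow_infConv (hc : ∀ z, c ≤ f z) (m : ℕ) (z : Z) :
    BddBelow (range fun w => f w + m * dist z w) := by
  refine ⟨c, ?_⟩
  rintro _ ⟨w, rfl⟩
  have : 0 ≤ (m : ℝ) * dist z w := by positivity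
  linarith [hc w]

theorem infConv_le (hc : ∀ z, c ≤ f z) (m : ℕ) (z : Z) : infConv f m z ≤ f z :=
  (ciInf_le (bddBelow_infConv hc m z) z).trans_eq (by simp)

theorem le_infConv (hc : ∀ z, c ≤ f z) (m : ℕ) (z : Z) : c ≤ infConv f m z := by
  have : Nonempty Z := ⟨z⟩
  refine le_ciInf fun w => ?_
  have : 0 ≤ (m : ℝ) * dist z w := by positivity
  linarith [hc w]

theorem infConv_le_add (hc : ∀ z, c ≤ f z) (m : ℕ) (z z' : Z) :
    infConv f m z ≤ infConv f m z' + m * dist z z' := by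
  have : Nonempty Z := ⟨z⟩
  rw [← sub_le_iff_le_add]
  refine le_ciInf fun w => ?_
  have h1 := ciInf_le (bddBelow_infConv hc m z) w
  have h2 := mul_le_mul_of_nonneg_left (dist_triangle z z' w) (Nat.cast_nonneg (α := ℝ) m)
  simp only [infConv]
  linarith

theorem continuous_infConv (hc : ∀ z, c ≤ f z) (m : ℕ) : Continuous (infConv f m) :=
  (LipschitzWith.of_le_add_mul m (infConv_le_add hc m)).continuous

theorem tendsto_infConv (hc : ∀ z, c ≤ f z) (hf : LowerSemicontinuous f) (z : Z) :
    Tendsto (fun m => infConv f m z) atTop (nhds (f z)) := by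
  have : Nonempty Z := ⟨z⟩
  refine tendsto_order.2 ⟨fun b hb => ?_, fun b hb =>
    Eventually.of_forall fun m => (infConv_le hc m z).trans_lt hb⟩
  obtain ⟨b', hbb', hb'⟩ := exists_between hb
  obtain ⟨δ, hδ, hball⟩ := Metric.eventually_nhds_iff.1 (hf z b' hb')
  -- Within distance `δ` of `z`, semicontinuity gives `f > b'`; farther away, the penalty is at
  -- least `N * δ ≥ b' - c`, which suffices because `f ≥ c`.
  obtain ⟨N, hN⟩ := exists_nat_ge ((b' - c) / δ)
  filter_upwards [eventually_ge_atTop N] with m hm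
  refine hbb'.trans_le (le_ciInf fun w => ?_)
  by_cases hw : dist w z < δ
  · have h0 : 0 ≤ (m : ℝ) * dist z w := by positivity
    linarith [hball hw]
  · have h1 : (b' - c) ≤ N * δ := (div_le_iff₀ hδ).1 hN
    have h2 : (N : ℝ) * δ ≤ m * dist z w := by
      rw [dist_comm]
      exact mul_le_mul (Nat.cast_le.2 hm) (not_lt.1 hw) hδ.le (Nat.cast_nonneg _)
    linarith [hc w]

end InfConvolution

/-! ### Weak continuity and semicontinuity of the continuation cost. -/

namespace Model

theorem integral_predictive (M : Model Θ A Y X) (n : ℕ) (h : Hist A Y n) (a : A) {g : Y → ℝ}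
    (hg : Integrable g (M.predictive n h a)) :
    ∫ y, g y ∂(M.predictive n h a)
      = ∫ θ, ∫ y, g y ∂(M.obs n (θ, h, a)) ∂(M.posterior n h) := by
  let κ : Kernel Θ Y := (M.obs n).comap (fun θ => (θ, h, a)) (by fun_prop)
  have h1 : M.predictive n h a = (κ ∘ₖ Kernel.const Unit (M.posterior n h)) () := rfl
  rw [h1] at hg ⊢
  rw [Kernel.integral_comp hg]
  rfl

end Model

section Semicontinuity

open Filter

variable [TopologicalSpace A] [TopologicalSpace Y]

/-- Fatou's lemma for weakly continuous kernels: integrating a bounded lower semicontinuous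
function gives a lower semicontinuous function. -/
theorem lowerSemicontinuous_integral {A : Type*} [TopologicalSpace A]
    [TopologicalSpace.MetrizableSpace A]
    [TopologicalSpace.MetrizableSpace Y] [OpensMeasurableSpace Y] {P : A → Measure Y}
    [∀ a, IsProbabilityMeasure (P a)] (hP : ∀ g : Y →ᵇ ℝ, Continuous fun a => ∫ y, g y ∂(P a))
    {f : A × Y → ℝ} {c C : ℝ} (hc : ∀ z, c ≤ f z) (hC : ∀ z, f z ≤ C)
    (hf : LowerSemicontinuous f) : LowerSemicontinuous fun a => ∫ y, f (a, y) ∂(P a) := by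
  let := TopologicalSpace.metrizableSpaceMetric A
  let := TopologicalSpace.metrizableSpaceMetric Y
  have hbd : ∀ m z, ‖infConv f m z‖ ≤ max |c| |C| := fun m z =>
    abs_le_max_abs_abs (le_infConv hc m z) ((infConv_le hc m z).trans (hC z))
  have hfm : ∀ a, Measurable fun y => f (a, y) := fun a =>
    (hf.comp (Continuous.prodMk_right a)).measurable
  have hcm : ∀ m a, Continuous fun y => infConv f m (a, y) := fun m a =>
    (continuous_infConv hc m).comp (Continuous.prodMk_right a)
  have hfi : ∀ a a', Integrable (fun y => f (a, y)) (P a') := fun a a' =>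
    Integrable.of_bound (hfm a).aestronglyMeasurable (max |c| |C|)
      (Eventually.of_forall fun y => abs_le_max_abs_abs (hc _) (hC _))
  have hmi : ∀ m a a', Integrable (fun y => infConv f m (a, y)) (P a') := fun m a a' =>
    Integrable.of_bound (hcm m a).measurable.aestronglyMeasurable (max |c| |C|)
      (Eventually.of_forall fun y => hbd m _)
  intro a b hb
  have h1 : Tendsto (fun m => ∫ y, infConv f m (a, y) ∂(P a)) atTop
      (nhds (∫ y, f (a, y) ∂(P a))) :=
    tendsto_integral_of_dominated_convergence (fun _ => max |c| |C|)
      (fun m => (hmi m a a).aestronglyMeasurable) (integrable_const _)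
      (fun m => Eventually.of_forall fun y => hbd m _)
      (Eventually.of_forall fun y => tendsto_infConv hc hf _)
  obtain ⟨m, hm⟩ := (h1.eventually_const_lt hb).exists
  let g : Y →ᵇ ℝ := BoundedContinuousFunction.ofNormedAddCommGroup
    (fun y => infConv f m (a, y)) (hcm m a) _ fun y => hbd m _
  -- Weak continuity needs an integrand that does not move with `a'`. The Lipschitz bound freezes
  -- its first coordinate at `a`, at the price `m * dist a a'`.
  have h2 : Continuous fun a' => ∫ y, infConv f m (a, y) ∂(P a') - m * dist a a' :=
    (hP g).sub (by fun_prop)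
  have h3 : b < ∫ y, infConv f m (a, y) ∂(P a) - m * dist a a := by simpa using hm
  filter_upwards [h2.continuousAt.eventually_const_lt h3] with a' ha'
  refine ha'.trans_le ?_
  rw [sub_le_iff_le_add]
  have h4 := integral_add (hfi a' a') (integrable_const ((m : ℝ) * dist a a'))
  rw [integral_const, probReal_univ, one_smul] at h4
  rw [← h4]
  refine integral_mono (hmi m a a') ((hfi a' a').add (integrable_const _)) fun y => ?_
  have h5 := infConv_le_add hc m (a, y) (a', y)
  have h6 : dist (a, y) (a', y) = dist a a' := by simp [Prod.dist_eq]
  rw [h6] at h5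
  exact h5.trans (by simpa using infConv_le hc m (a', y))

namespace Model

variable (M : Model Θ A Y X) {ε lam : ℝ}

/-- Dominated convergence over the posterior, which does not depend on the query, carries weak
continuity from each parameter to the mixture. -/
theorem continuous_integral_predictive [FirstCountableTopology A] [OpensMeasurableSpace Y]
    (hweak : M.WeaklyContinuous) (n : ℕ) (h : Hist A Y n) (g : Y →ᵇ ℝ) :
    Continuous fun a => ∫ y, g y ∂(M.predictive n h a) := by
  simp_rw [fun a => M.integral_predictive n h a (g.integrable _)]
  refine continuous_of_dominated (bound := fun _ => ‖g‖) (fun a => ?_)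
    (fun a => Eventually.of_forall fun θ => ?_) (integrable_const _)
    (Eventually.of_forall fun θ => hweak n θ h g)
  · let κ : Kernel Θ Y := (M.obs n).comap (fun θ => (θ, h, a)) (by fun_prop)
    exact (StronglyMeasurable.integral_kernel (κ := κ)
      g.continuous.measurable.stronglyMeasurable).aestronglyMeasurable
  · simpa using g.norm_integral_le_norm (M.obs n (θ, h, a))

theorem lowerSemicontinuous_qCont [TopologicalSpace.MetrizableSpace A]
    [TopologicalSpace.MetrizableSpace Y] [OpensMeasurableSpace Y]
    (hr : ∀ n, Measurable (M.bestSuccess (A := A) (Y := Y) ε n)) (hlam : 0 ≤ lam)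
    (hweak : M.WeaklyContinuous) (n : ℕ) (h : Hist A Y n)
    (hV : LowerSemicontinuous fun z : A × Y => M.value ε lam (n + 1) (h.append z.1 z.2)) :
    LowerSemicontinuous (M.qCont ε lam n h) := by
  have h1 : M.qCont ε lam n h = fun a =>
      1 + ∫ y, M.value ε lam (n + 1) (h.append a y) ∂(M.predictive n h a) := by
    funext a
    rw [qCont, lowerIntegral_eq_integral]
    -- Semicontinuity makes the value measurable in the observation, so neither regularity nor an
    -- actor is needed here.
    refine Integrable.of_bound (hV.comp (Continuous.prodMk_right a)).measurable.aestronglyMeasurable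
      lam (Eventually.of_forall fun y => ?_)
    exact abs_le.2 ⟨M.neg_le_value hr hlam _ _, (M.value_nonpos hr hlam _ _).trans hlam⟩
  rw [h1]
  have h2 : LowerSemicontinuous fun a =>
      ∫ y, M.value ε lam (n + 1) (h.append a y) ∂(M.predictive n h a) :=
    lowerSemicontinuous_integral (P := fun a => M.predictive n h a)
      (f := fun z : A × Y => M.value ε lam (n + 1) (h.append z.1 z.2))
      (M.continuous_integral_predictive hweak n h) (c := -lam) (C := 0)
      (fun z => M.neg_le_value hr hlam _ _) (fun z => M.value_nonpos hr hlam _ _) hV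
  exact lowerSemicontinuous_const.add h2

end Model

end Semicontinuity

end

end SeqTest

/-! ### The proposition. -/

theorem mainTheorem3 {Θ A Y X : Type*}
    [TopologicalSpace Θ] [CompactSpace Θ] [TopologicalSpace.MetrizableSpace Θ]
    [MeasurableSpace Θ] [BorelSpace Θ]
    [TopologicalSpace A] [CompactSpace A] [TopologicalSpace.MetrizableSpace A]
    [MeasurableSpace A] [BorelSpace A] [Nonempty A]
    [TopologicalSpace Y] [CompactSpace Y] [TopologicalSpace.MetrizableSpace Y]
    [MeasurableSpace Y] [BorelSpace Y]
    [TopologicalSpace X] [CompactSpace X] [TopologicalSpace.MetrizableSpace X] [Nonempty X]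
    (M : SeqTest.Model Θ A Y X) (ε lam : ℝ) (hε : 0 < ε) (hlam : 0 ≤ lam)
    (hloss : ∀ θ, Continuous (M.loss θ)) (hweak : M.WeaklyContinuous) :
    (∀ actor : ∀ n, SeqTest.Hist A Y n → A,
      (∀ n, Measurable (actor n)) →
      (∀ n h, M.Regular n h → IsMinOn (M.qCont ε lam n h) Set.univ (actor n h)) →
        (∀ n h, M.Regular n h →
          (∀ a, MeasureTheory.Integrable
              (fun y => M.value ε lam (n + 1) (h.append a y)) (M.predictive n h a) ∧
            M.qCont ε lam n h a =
              1 + ∫ y, M.value ε lam (n + 1) (h.append a y) ∂(M.predictive n h a)) ∧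
          M.value ε lam n h = min (M.qStop ε lam n h) (⨅ a, M.qCont ε lam n h a)) ∧
        (∃ π : SeqTest.Policy A Y, M.FollowsActor ε lam actor π) ∧
        (∀ π : SeqTest.Policy A Y, M.FollowsActor ε lam actor π →
          (∀ n h, M.Regular n h → M.Admissible π n (M.givenHist n h) ∧
            M.cost ε lam π n (M.givenHist n h) = M.value ε lam n h) ∧
          M.Admissible π 0 M.start ∧
          ∀ π' : SeqTest.Policy A Y, M.Admissible π' 0 M.start →
            M.cost ε lam π 0 M.start ≤ M.cost ε lam π' 0 M.start)) ∧
    (∀ (π : SeqTest.Policy A Y) (k : ℕ),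
      ∀ᵐ z ∂(M.start.bind (M.run π 0 k)), M.Regular (0 + k) z.2) ∧
    (∀ (n : ℕ) (h : SeqTest.Hist A Y n),
      LowerSemicontinuous (fun z : A × Y => M.value ε lam (n + 1) (h.append z.1 z.2)) →
        LowerSemicontinuous (M.qCont ε lam n h) ∧
        ∃ a, IsMinOn (M.qCont ε lam n h) Set.univ a) := by

  have hr := M.measurable_bestSuccess hloss ε
  refine ⟨fun actor hact hmin => ⟨fun n h hh => ⟨fun a => ?_, ?_⟩, ?_, fun π hπ => ⟨?_, ?_⟩⟩,
    M.ae_regular_run, fun n h hV => ?_⟩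
  · have hi := M.integrable_value hr hlam hact hmin hh a
    exact ⟨hi, by rw [SeqTest.Model.qCont, SeqTest.lowerIntegral_eq_integral _ _ hi]⟩
  · exact M.bellman hr hlam hact hmin n h hh
  · exact M.exists_followsActor hr hlam hact hmin
  · exact M.optimal_givenHist hr hlam hact hmin hπ
  · exact M.optimal_start hr hlam hact hmin hπ
  · have hlsc := M.lowerSemicontinuous_qCont hr hlam hweak n h hV
    obtain ⟨a, -, ha⟩ := LowerSemicontinuousOn.exists_isMinOn univ_nonempty isCompact_univ
      (hlsc.lowerSemicontinuousOn univ)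
    exact ⟨hlsc, a, ha⟩
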